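/- **Conventions.** Let $q\in\mathbb C$ be not a root of unity (for instance $|q|<1$), let $t\in\mathbb C$ with $|t|<1$, and let $n,N\ge 0$ be integers. Put $(q;q)_m=\prod_{k=1}^m(1-q^k)$, $\binom mk_q=\frac{(q;q)_m}{(q;q)_k(q;q)_{m-k}}$ and $h_m(z;q)=\sum_{k=0}^m\binom mk_q z^k$. For a partition $\lambda$ with conjugate $\lambda'$ put $$h_{\lambda'}(a,b;q)=\prod_{i\ge1}a^{\lambda_{2i-1}-\lambda_{2i}}\,h_{\lambda_{2i-1}-\lambda_{2i}}(b/a;q)\,h_{\lambda_{2i}-\lambda_{2i+1}}(ab;q),$$ which is a polynomial in $a,b$. Let $P_{\lambda/\mu}(x;q,0)$ be the skew $q$-Whittaker polynomial (the skew Macdonald polynomial at $t=0$) in $x=(x_1,\dots,x_N)$, that is $$P_{\lambda/\mu}(x;q,0)=\sum\prod_{k=1}^N x_k^{|\nu^{(k-1)}|-|\nu^{(k)}|}\prod_{i\ge1}\frac{(q;q)_{\nu^{(k-1)}_i-\nu^{(k-1)}_{i+1}}}{(q;q)_{\nu^{(k-1)}_i-\nu^{(k)}_i}\,(q;q)_{\nu^{(k)}_i-\nu^{(k-1)}_{i+1}}},$$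 summed over all chains $\lambda=\nu^{(0)}\supseteq\nu^{(1)}\supseteq\dots\supseteq\nu^{(N)}=\mu$ of partitions with $\nu^{(k-1)}_i\ge\nu^{(k)}_i\ge\nu^{(k-1)}_{i+1}$ for all $i,k$. Define $$Z_n(x;q,t;a,b,c,d)=\sum_{\mu\subseteq\lambda,\ \lambda_1\le n}\frac{h_{n-\lambda_1}(ab;q)\,h_{\lambda'}(a,b;q)}{(q;q)_{n-\lambda_1}\prod_{i\ge1}(q;q)_{\lambda_i-\lambda_{i+1}}}\,P_{\lambda/\mu}(x;q,0)\,t^{|\mu|/2}h_{\mu'}(c/\sqrt t,d/\sqrt t;q),$$ where $t^{|\mu|/2}h_{\mu'}(c/\sqrt t,d/\sqrt t;q)$ is a polynomial in $t,c,d$ (which gives its meaning at $t=0$). **Proposition 3.6.** Let $x_1,\dots,x_N\in\mathbb C\setminus\{0\}$ and $a,b,c,d\in\mathbb C$. The series $Z_n(x;q,t;a,b,c,d)$ converges absolutely, and: 1. the expression $\prod_i x_i^{-n/2}\,Z_n(x;q,t;a,b,c,d)$ is invariant under $x_i\mapsto x_i^{-1}$ for $i\in S$, for every $S\subseteq\{1,\dots,N\}$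 with $|S|$ even; 2. if $a,b,c,d\neq0$, the expression $(abcd)^{-n/2}\prod_i x_i^{-n/2}\,Z_n(x;q,t;a,b,c,d)$ is invariant under the simultaneous transformations $x_i\mapsto x_i^{-1}$ for $i\in S$ and $a\mapsto a^{-1}$, for every $S\subseteq\{1,\dots,N\}$ with $|S|$ odd; in particular under inverting $a$ together with any single $x_i$. Here the half-integer powers are formed with arbitrary fixed square roots of $x_i,a,b,c,d$, and inverting a variable inverts its chosen square root. -/

import Mathlib

namespace FreeBoundary

noncomputable section

/-- The `q`-Pochhammer symbol `(q;q)_m = (1 - q)(1 - q^2) ⋯ (1 - q^m)`. -/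
def qPoch (q : ℂ) (m : ℕ) : ℂ :=
  ∏ k ∈ Finset.range m, (1 - q ^ (k + 1))

/-- The Gaussian binomial coefficient, for `k ≤ m`. -/
def qBinom (q : ℂ) (m k : ℕ) : ℂ :=
  qPoch q m / (qPoch q k * qPoch q (m - k))

/-- The Rogers-Szegő polynomial `h_m(z;q)`. -/
def rogersSzego (q : ℂ) (m : ℕ) (z : ℂ) : ℂ :=
  ∑ k ∈ Finset.range (m + 1), qBinom q m k * z ^ k

/-- The polynomial `a^m h_m(b/a;q)` in `a, b`, written so that it also makes sense at `a = 0`. -/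
def rogersSzegoHom (q : ℂ) (m : ℕ) (a b : ℂ) : ℂ :=
  ∑ k ∈ Finset.range (m + 1), qBinom q m k * a ^ (m - k) * b ^ k

/-- `rogersSzegoHom q m a b` is `a^m h_m(b/a;q)` whenever the latter is defined. -/
theorem rogersSzegoHom_eq (q : ℂ) (m : ℕ) {a : ℂ} (ha : a ≠ 0) (b : ℂ) :
    rogersSzegoHom q m a b = a ^ m * rogersSzego q m (b / a) := by
  unfold rogersSzegoHom rogersSzego
  rw [Finset.mul_sum]
  refine Finset.sum_congr rfl fun k hk => ?_
  have hk' : k ≤ m := Nat.lt_succ_iff.mp (Finset.mem_range.mp hk)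
  obtain ⟨j, rfl⟩ := Nat.exists_eq_add_of_le hk'
  rw [Nat.add_sub_cancel_left, div_pow, pow_add]
  field_simp

/-- The multiplicity `m_{i+1}(ν)` of the part `i + 1` in the partition `ν`,
that is, `ν'_{i+1} - ν'_{i+2}`. -/
def mult (ν : YoungDiagram) (i : ℕ) : ℕ :=
  ν.colLen i - ν.colLen (i + 1)

/-- `h_ν(a,b;q) = ∏_{i ≥ 1} a^{m_{2i-1}} h_{m_{2i-1}}(b/a;q) h_{m_{2i}}(ab;q)`, where `m_j` is the
multiplicity of the part `j` in `ν`. The index `i` below stands for the part `i + 1`. -/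
def hPoly (q a b : ℂ) (ν : YoungDiagram) : ℂ :=
  ∏ i ∈ Finset.range (ν.rowLen 0),
    if Even i then rogersSzegoHom q (mult ν i) a b
    else rogersSzego q (mult ν i) (a * b)

/-- The polynomial `t^{|ν|/2} h_ν(c/√t, d/√t; q)` in `t, c, d` (only integer powers of `t` occur),
written so that it also makes sense at `t = 0`; see `hScaled_eq`. -/
def hScaled (q t c d : ℂ) (ν : YoungDiagram) : ℂ :=
  ∏ i ∈ Finset.range (ν.rowLen 0),
    t ^ ((i / 2) * mult ν i) *
      (if Even i then rogersSzegoHom q (mult ν i) c d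
       else rogersSzegoHom q (mult ν i) t (c * d))

theorem card_eq_sum_colLen (ν : YoungDiagram) :
    ν.card = ∑ i ∈ Finset.range (ν.rowLen 0), ν.colLen i := by
  have h : ∀ c ∈ ν.cells, c.2 ∈ Finset.range (ν.rowLen 0) := by
    rintro ⟨i, j⟩ hc
    rw [Finset.mem_range, ← YoungDiagram.mem_iff_lt_rowLen]
    exact ν.up_left_mem (Nat.zero_le i) le_rfl ((YoungDiagram.mem_cells _).1 hc)
  rw [YoungDiagram.card, Finset.card_eq_sum_card_fiberwise h]
  refine Finset.sum_congr rfl fun j _ => ?_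
  rw [YoungDiagram.colLen_eq_card]
  rfl

theorem sum_mult (ν : YoungDiagram) (m : ℕ) :
    ∑ i ∈ Finset.range m, (i + 1) * mult ν i + m * ν.colLen m
      = ∑ i ∈ Finset.range m, ν.colLen i := by
  induction m with
  | zero => simp
  | succ m ih =>
    rw [Finset.sum_range_succ, Finset.sum_range_succ, ← ih, mult]
    have h := ν.colLen_anti m (m + 1) (Nat.le_succ m)
    obtain ⟨e, he⟩ := Nat.exists_eq_add_of_le h
    rw [he, Nat.add_sub_cancel_left]
    ring

theorem card_eq_sum_mult (ν : YoungDiagram) :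
    ν.card = ∑ i ∈ Finset.range (ν.rowLen 0), (i + 1) * mult ν i := by
  have h0 : ν.colLen (ν.rowLen 0) = 0 := by
    by_contra h
    have h1 : (0, ν.rowLen 0) ∈ ν := YoungDiagram.mem_iff_lt_colLen.2 (Nat.pos_of_ne_zero h)
    exact lt_irrefl _ (YoungDiagram.mem_iff_lt_rowLen.1 h1)
  rw [card_eq_sum_colLen, ← sum_mult, h0, Nat.mul_zero, Nat.add_zero]

/-- For every nonzero square root `s` of `t`, `hScaled` is `t^{|ν|/2} h_ν(c/√t, d/√t; q)`. -/
theorem hScaled_eq (q c d : ℂ) {s : ℂ} (hs : s ≠ 0) (ν : YoungDiagram) :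
    hScaled q (s ^ 2) c d ν = s ^ ν.card * hPoly q (c / s) (d / s) ν := by
  rw [card_eq_sum_mult, ← Finset.prod_pow_eq_pow_sum, hPoly, hScaled, ← Finset.prod_mul_distrib]
  refine Finset.prod_congr rfl fun i _ => ?_
  generalize mult ν i = m
  rcases Nat.even_or_odd' i with ⟨j, rfl | rfl⟩
  · have e1 : 2 * j / 2 = j := by omega
    rw [if_pos (even_two_mul j), if_pos (even_two_mul j), e1]
    unfold rogersSzegoHom
    rw [Finset.mul_sum, Finset.mul_sum]
    refine Finset.sum_congr rfl fun k hk => ?_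
    have hk' : k ≤ m := Nat.lt_succ_iff.mp (Finset.mem_range.mp hk)
    obtain ⟨l, rfl⟩ := Nat.exists_eq_add_of_le hk'
    rw [Nat.add_sub_cancel_left, div_pow, div_pow, ← pow_mul]
    have : s ^ ((2 * j + 1) * (k + l)) = s ^ (2 * (j * (k + l))) * s ^ k * s ^ l := by
      rw [← pow_add, ← pow_add]; congr 1; ring
    rw [this]
    field_simp
  · have e1 : (2 * j + 1) / 2 = j := by omega
    have e2 : ¬ Even (2 * j + 1) := by simp
    have e3 : c / s * (d / s) = c * d / s ^ 2 := by field_simp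
    rw [if_neg e2, if_neg e2, e1, e3, rogersSzegoHom_eq q m (pow_ne_zero 2 hs), ← mul_assoc]
    congr 1
    rw [← pow_mul, ← pow_mul, ← pow_add]
    congr 1
    ring

theorem finite_subdiagrams (lam : YoungDiagram) : {ν : YoungDiagram | ν ≤ lam}.Finite := by
  refine Set.Finite.of_finite_image (f := YoungDiagram.cells)
    ((lam.cells.powerset.finite_toSet).subset ?_) ?_
  · rintro _ ⟨ν, hν, rfl⟩
    exact Finset.mem_coe.2 (Finset.mem_powerset.2 (YoungDiagram.cells_subset_iff.2 hν))
  · intro ν _ κ _ h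
    exact YoungDiagram.ext h

/-- The finite set of partitions `ν ⊆ lam`. -/
def subdiagrams (lam : YoungDiagram) : Finset YoungDiagram :=
  (finite_subdiagrams lam).toFinset

/-- `lam / μ` is a horizontal strip: `lam_1 ≥ μ_1 ≥ lam_2 ≥ μ_2 ≥ ⋯`. -/
def IsHorizontalStrip (lam μ : YoungDiagram) : Prop :=
  ∀ i, μ.rowLen i ≤ lam.rowLen i ∧ lam.rowLen (i + 1) ≤ μ.rowLen i

open Classical in
/-- The skew `q`-Whittaker polynomial `P_{lam/μ}(x;q,0)` in a single variable `x`: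
`x^{|lam|-|μ|} ∏_{i ≥ 1} (q;q)_{lam_i-lam_{i+1}} / ((q;q)_{lam_i-μ_i} (q;q)_{μ_i-lam_{i+1}})`
if `lam / μ` is a horizontal strip, and `0` otherwise. -/
def whittakerOne (q x : ℂ) (lam μ : YoungDiagram) : ℂ :=
  if IsHorizontalStrip lam μ then
    x ^ (lam.card - μ.card) *
      ∏ i ∈ Finset.range (lam.colLen 0),
        qPoch q (lam.rowLen i - lam.rowLen (i + 1)) /
          (qPoch q (lam.rowLen i - μ.rowLen i) * qPoch q (μ.rowLen i - lam.rowLen (i + 1)))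
  else 0

open Classical in
/-- The skew `q`-Whittaker polynomial `P_{lam/μ}(x_1,…,x_N;q,0)` (the skew Macdonald polynomial at
`t = 0`), as the generating function of Gelfand-Tsetlin patterns, i.e. of chains
`μ = ν⁰ ⊆ ν¹ ⊆ ⋯ ⊆ νᴺ = lam` of horizontal strips weighted by the one-variable polynomials,
organised by the branching rule
`P_{lam/μ}(x_1,…,x_N) = ∑_ν P_{lam/ν}(x_1) P_{ν/μ}(x_2,…,x_N)`. -/
def whittaker (q : ℂ) : (N : ℕ) → (Fin N → ℂ) → YoungDiagram → YoungDiagram → ℂ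
  | 0, _, lam, μ => if lam = μ then 1 else 0
  | N + 1, x, lam, μ =>
      ∑ ν ∈ subdiagrams lam, whittakerOne q (x 0) lam ν * whittaker q N (Fin.tail x) ν μ

/-- The index set of the sum `Z_n`: pairs `(lam, μ)` of partitions with `μ ⊆ lam`, `lam_1 ≤ n`. -/
def Pairs (n : ℕ) : Type :=
  {p : YoungDiagram × YoungDiagram // p.2 ≤ p.1 ∧ p.1.rowLen 0 ≤ n}

/-- The summand of `Z_n(x;q,t;a,b,c,d)` indexed by `(lam, μ)`. -/
def zTerm (n : ℕ) {N : ℕ} (x : Fin N → ℂ) (q t a b c d : ℂ) (p : Pairs n) : ℂ :=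
  rogersSzego q (n - p.1.1.rowLen 0) (a * b) * hPoly q a b p.1.1.transpose /
      (qPoch q (n - p.1.1.rowLen 0) *
        ∏ i ∈ Finset.range (p.1.1.colLen 0), qPoch q (p.1.1.rowLen i - p.1.1.rowLen (i + 1))) *
    whittaker q N x p.1.1 p.1.2 * hScaled q t c d p.1.2.transpose

/-- `Z_n(x;q,t;a,b,c,d)`. -/
def Z (n : ℕ) {N : ℕ} (x : Fin N → ℂ) (q t a b c d : ℂ) : ℂ :=
  ∑' p : Pairs n, zTerm n x q t a b c d p

/-- Invert the entries of `x` with index in `S`, and keep the others. -/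
def invertOn {N : ℕ} (S : Finset (Fin N)) (x : Fin N → ℂ) : Fin N → ℂ :=
  fun i => if i ∈ S then (x i)⁻¹ else x i

end

end FreeBoundary

/-!
The sum `Z_n` is a matrix element `⟨a, b| T(x_1) ⋯ T(x_N) |R⟩`, where `T(x)` is the operator with
matrix entries `P_{lam/μ}(x;q,0)`, the covector `⟨a, b|` is the left boundary weight (`leftWeight`)
and `|R⟩` contains the dependence on `c, d, t`. The right boundary plays no role in the symmetry.
Three facts about the other factors suffice.

* The operators `T(x)` and `T(y)` commute (`sum_whittakerOne_comm`). The weight of a chain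
  `lam ⊇ ν ⊇ μ` is a product over the rows of `ν` in which neighbouring rows interact. Adding one
  row at a time, one shows by induction that the moments
  `∑_ν binom(lam_1 - ν_1, l)_q y^l weight(ν)` of the first row are unchanged when `x` and `y` are
  exchanged (`chainWeight_moment_comm`). By the `q`-Vandermonde convolution, a new row transforms
  these moments linearly among themselves, and the coefficients are visibly symmetric
  (`sum_rowWeight_mul_rowWeight`, `momentCoeff_comm`).
* One has `⟨a, 0| T(b) = ⟨a, b|` (`sum_leftWeight_mul_whittakerOne`), as the sum over `lam`
  factorizes into sums over the individual rows, each of which is a Rogers-Szegő polynomial. Since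
  `⟨a, b|` is symmetric in `a, b`, it follows that `⟨a, b| = ⟨0, 0| T(a) T(b)`. Hence
  `a, b, x_1, …, x_N` enter symmetrically (`leftSum_eq_cons_cons`, `whittakerList_perm`).
* Rogers-Szegő polynomials are palindromic, hence `⟨a⁻¹, b⁻¹| = (ab)^{-n} ⟨a, b|`
  (`leftWeight_inv`).

Any two of the variables `a, b, x_1, …, x_N` can therefore be moved to the left boundary and
inverted there at the cost of the factor `(yz)^{-n}`, and so can any even number of them
(`leftSum_invertOn`). For a set of variables `x_i` of odd size, `a` is the additional variable.

The series converges absolutely since the right boundary weight decays exponentially in `|μ|`, while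
the number of columns is bounded by `n`, `|lam| - |μ|` is bounded, and the other factors grow more
slowly than any exponential (`summable_zTerm`).
-/

namespace FreeBoundary

noncomputable section

/-! ### Gaussian binomial coefficients -/

/-- The Gaussian binomial coefficient for all `m`, `k`, equal to `0` for `k > m` (unlike `qBinom`,
whose value there comes from truncated subtraction). -/
def gaussBinom (q : ℂ) (m k : ℕ) : ℂ :=
  if k ≤ m then qBinom q m k else 0

theorem qPoch_zero (q : ℂ) : qPoch q 0 = 1 := by simp [qPoch]

theorem qPoch_succ (q : ℂ) (m : ℕ) : qPoch q (m + 1) = qPoch q m * (1 - q ^ (m + 1)) := by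
  simp [qPoch, Finset.prod_range_succ]

theorem qPoch_ne_zero {q : ℂ} (hq : ∀ k : ℕ, 0 < k → q ^ k ≠ 1) (m : ℕ) : qPoch q m ≠ 0 :=
  Finset.prod_ne_zero_iff.2 fun k _ => sub_ne_zero.2 (hq (k + 1) k.succ_pos).symm

theorem gaussBinom_of_le {q : ℂ} {m k : ℕ} (h : k ≤ m) :
    gaussBinom q m k = qPoch q m / (qPoch q k * qPoch q (m - k)) := by
  rw [gaussBinom, if_pos h, qBinom]

theorem gaussBinom_of_lt {q : ℂ} {m k : ℕ} (h : m < k) : gaussBinom q m k = 0 := by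
  rw [gaussBinom, if_neg (by omega)]

theorem gaussBinom_zero_right {q : ℂ} (hq : ∀ k : ℕ, 0 < k → q ^ k ≠ 1) (m : ℕ) :
    gaussBinom q m 0 = 1 := by
  rw [gaussBinom_of_le m.zero_le, qPoch_zero, one_mul, Nat.sub_zero, div_self (qPoch_ne_zero hq m)]

theorem gaussBinom_self {q : ℂ} (hq : ∀ k : ℕ, 0 < k → q ^ k ≠ 1) (m : ℕ) :
    gaussBinom q m m = 1 := by
  rw [gaussBinom_of_le le_rfl, Nat.sub_self, qPoch_zero, mul_one, div_self (qPoch_ne_zero hq m)]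

/-- The `q`-Pascal rule. -/
theorem gaussBinom_succ_succ {q : ℂ} (hq : ∀ k : ℕ, 0 < k → q ^ k ≠ 1) (m k : ℕ) :
    gaussBinom q (m + 1) (k + 1) = q ^ (m - k) * gaussBinom q m k + gaussBinom q m (k + 1) := by
  rcases lt_trichotomy m k with h | rfl | h
  · rw [gaussBinom_of_lt (by omega), gaussBinom_of_lt h, gaussBinom_of_lt (by omega)]; simp
  · rw [gaussBinom_self hq, gaussBinom_self hq, gaussBinom_of_lt (by omega)]; simp
  · obtain ⟨j, rfl⟩ := Nat.exists_eq_add_of_lt h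
    rw [gaussBinom_of_le (by omega), gaussBinom_of_le (by omega), gaussBinom_of_le (by omega)]
    have e1 : k + j + 1 + 1 - (k + 1) = j + 1 := by omega
    have e2 : k + j + 1 - k = j + 1 := by omega
    have e3 : k + j + 1 - (k + 1) = j := by omega
    rw [e1, e2, e3, qPoch_succ q (k + j + 1), qPoch_succ q k, qPoch_succ q j]
    have := qPoch_ne_zero hq j
    have := qPoch_ne_zero hq k
    have := sub_ne_zero.2 (hq (k + 1) k.succ_pos).symm
    have := sub_ne_zero.2 (hq (j + 1) j.succ_pos).symm
    field_simp
    ring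

/-- The `q`-Vandermonde convolution. -/
theorem gaussBinom_add {q : ℂ} (hq : ∀ k : ℕ, 0 < k → q ^ k ≠ 1) (A B c : ℕ) :
    gaussBinom q (A + B) c = ∑ r ∈ Finset.range (c + 1),
      gaussBinom q A (c - r) * gaussBinom q B r * q ^ (r * (A - (c - r))) := by
  induction B generalizing c with
  | zero =>
    rw [Finset.sum_eq_single 0]
    · simp [gaussBinom_zero_right hq]
    · intro r _ hr
      rw [gaussBinom_of_lt (m := 0) (k := r) (by omega)]; simp
    · simp
  | succ B ih =>
    cases c with
    | zero => simp [gaussBinom_zero_right hq]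
    | succ c =>
      rw [← add_assoc, gaussBinom_succ_succ hq, ih, ih, Finset.sum_range_succ' _ (c + 1),
        Finset.sum_range_succ' _ (c + 1), Finset.mul_sum, ← add_assoc, ← Finset.sum_add_distrib]
      congr 1
      · refine Finset.sum_congr rfl fun r hr => ?_
        have hr' : r ≤ c := Nat.lt_succ_iff.mp (Finset.mem_range.mp hr)
        rw [gaussBinom_succ_succ hq B r, Nat.add_sub_add_right]
        by_cases h1 : c - r ≤ A
        · by_cases h2 : r ≤ B
          · have : q ^ (A + B - c) * q ^ (r * (A - (c - r)))
                = q ^ (B - r) * q ^ ((r + 1) * (A - (c - r))) := by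
              rw [← pow_add, ← pow_add]
              congr 1
              rw [add_mul]
              omega
            linear_combination gaussBinom q A (c - r) * gaussBinom q B r * this
          · rw [gaussBinom_of_lt (m := B) (k := r) (by omega)]; ring
        · rw [gaussBinom_of_lt (m := A) (k := c - r) (by omega)]; ring
      · simp [gaussBinom_zero_right hq]

theorem gaussBinom_mul_mul {q : ℂ} (hq : ∀ k : ℕ, 0 < k → q ^ k ≠ 1) {m u k l : ℕ}
    (hlk : l ≤ k) (hku : k ≤ u) (hum : u ≤ m) :
    gaussBinom q m k * gaussBinom q k l * gaussBinom q (m - k) (u - k) =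
      qPoch q m / (qPoch q (m - u) * qPoch q l * (qPoch q (k - l) * qPoch q (u - k))) := by
  rw [gaussBinom_of_le (by omega), gaussBinom_of_le hlk, gaussBinom_of_le (by omega)]
  have e : m - k - (u - k) = m - u := by omega
  rw [e]
  have := qPoch_ne_zero hq k
  have := qPoch_ne_zero hq (m - k)
  have := qPoch_ne_zero hq (m - u)
  have := qPoch_ne_zero hq l
  have := qPoch_ne_zero hq (k - l)
  have := qPoch_ne_zero hq (u - k)
  field_simp

/-- The coefficients by which the binomial moments transform when one row is added; see
`sum_rowWeight_mul_rowWeight`. -/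
def momentCoeff (q x y : ℂ) (m u l : ℕ) : ℂ :=
  ∑ k ∈ Finset.range (u + 1),
    gaussBinom q m k * gaussBinom q k l * gaussBinom q (m - k) (u - k) * (x ^ k * y ^ (u - k + l))

theorem momentCoeff_comm {q : ℂ} (hq : ∀ k : ℕ, 0 < k → q ^ k ≠ 1) (x y : ℂ) (m u l : ℕ) :
    momentCoeff q x y m u l = momentCoeff q y x m u l := by
  unfold momentCoeff
  by_cases hum : u ≤ m
  swap
  · refine Finset.sum_congr rfl fun k hk => ?_
    by_cases h : k ≤ m
    · rw [gaussBinom_of_lt (m := m - k) (k := u - k) (by omega)]; simp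
    · rw [gaussBinom_of_lt (m := m) (k := k) (by omega)]; simp
  by_cases hl : l ≤ u
  swap
  · refine Finset.sum_congr rfl fun k hk => ?_
    have := Finset.mem_range.1 hk
    rw [gaussBinom_of_lt (m := k) (k := l) (by omega)]; simp
  have key : ∀ x y : ℂ, ∑ k ∈ Finset.range (u + 1), gaussBinom q m k * gaussBinom q k l *
        gaussBinom q (m - k) (u - k) * (x ^ k * y ^ (u - k + l)) =
      ∑ p ∈ Finset.range (u - l + 1),
        qPoch q m / (qPoch q (m - u) * qPoch q l * (qPoch q p * qPoch q (u - l - p))) *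
          (x ^ (p + l) * y ^ (u - l - p + l)) := by
    intro x y
    have e : u + 1 = l + (u - l + 1) := by omega
    rw [e, Finset.sum_range_add, Finset.sum_eq_zero, zero_add]
    · refine Finset.sum_congr rfl fun p hp => ?_
      have := Finset.mem_range.1 hp
      rw [gaussBinom_mul_mul hq (by omega) (by omega) hum, Nat.add_sub_cancel_left,
        show u - (l + p) = u - l - p by omega, add_comm l p]
    · intro k hk
      rw [gaussBinom_of_lt (m := k) (k := l) (Finset.mem_range.1 hk)]; simp
  rw [key, key, ← Finset.sum_range_reflect]
  refine Finset.sum_congr rfl fun p hp => ?_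
  have := Finset.mem_range.1 hp
  rw [show u - l + 1 - 1 - p = u - l - p by omega, show u - l - (u - l - p) = p by omega]
  ring

/-! ### Binomial moments of two-step chains -/

/-- The contribution of one row to the one-variable `q`-Whittaker polynomial `P_{lam/ν}(x;q,0)`:
here `p = lam_i`, `p' = lam_{i+1}` and `v = ν_i`. -/
def rowWeight (q x : ℂ) (p p' v : ℕ) : ℂ :=
  if p' ≤ v ∧ v ≤ p then x ^ (p - v) * gaussBinom q (p - p') (p - v) else 0

theorem rowWeight_of_not {q x : ℂ} {p p' v : ℕ} (h : ¬(p' ≤ v ∧ v ≤ p)) :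
    rowWeight q x p p' v = 0 := if_neg h

theorem sum_rowWeight_mul_rowWeight {q : ℂ} (hq : ∀ k : ℕ, 0 < k → q ^ k ≠ 1) (x y : ℂ)
    {n p p' u v' : ℕ} (hv : v' ≤ p') (hp : p' ≤ p) (hn : p ≤ n) (hu : u ≤ p) (l : ℕ) :
    ∑ v ∈ Finset.range (n + 1), gaussBinom q (p - v) l * y ^ l *
        (rowWeight q x p p' v * rowWeight q y v v' u) =
      ∑ r ∈ Finset.range (p - u + 1), q ^ (r * (p - p' - (p - u - r))) *
        momentCoeff q x y (p - p') (p - u - r) l * (gaussBinom q (p' - v') r * y ^ r) := by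
  have h1 : ∑ v ∈ Finset.range (n + 1), gaussBinom q (p - v) l * y ^ l *
        (rowWeight q x p p' v * rowWeight q y v v' u) =
      ∑ v ∈ Finset.Ico u (p + 1), gaussBinom q (p - v) l * y ^ l *
        (rowWeight q x p p' v * rowWeight q y v v' u) := by
    symm
    refine Finset.sum_subset (fun v hv => ?_) fun v _ hv => ?_
    · rw [Finset.mem_Ico] at hv
      rw [Finset.mem_range]
      omega
    · rw [Finset.mem_Ico] at hv
      by_cases h : v ≤ p
      · rw [rowWeight_of_not (p := v) (p' := v') (v := u) (by omega)]; simp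
      · rw [rowWeight_of_not (p := p) (p' := p') (v := v) (by omega)]; simp
  rw [h1, Finset.sum_Ico_eq_sum_range, show p + 1 - u = p - u + 1 by omega,
    ← Finset.sum_range_reflect]
  have h2 : ∀ k ∈ Finset.range (p - u + 1),
      gaussBinom q (p - (u + (p - u + 1 - 1 - k))) l * y ^ l *
        (rowWeight q x p p' (u + (p - u + 1 - 1 - k)) *
          rowWeight q y (u + (p - u + 1 - 1 - k)) v' u) =
      ∑ r ∈ Finset.range (p - u - k + 1), q ^ (r * (p - p' - (p - u - r))) *
        (gaussBinom q (p - p') k * gaussBinom q k l *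
          gaussBinom q (p - p' - k) (p - u - r - k) * (x ^ k * y ^ (p - u - r - k + l))) *
        (gaussBinom q (p' - v') r * y ^ r) := by
    intro k hk
    have hk := Finset.mem_range.1 hk
    rw [show u + (p - u + 1 - 1 - k) = p - k by omega]
    by_cases hkm : k ≤ p - p'
    swap
    · rw [rowWeight_of_not (p := p) (p' := p') (v := p - k) (by omega)]
      simp [gaussBinom_of_lt (q := q) (m := p - p') (k := k) (by omega)]
    have e1 : rowWeight q x p p' (p - k) = x ^ k * gaussBinom q (p - p') k := by
      rw [rowWeight, if_pos (by omega), show p - (p - k) = k by omega]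
    have e2 : rowWeight q y (p - k) v' u =
        y ^ (p - u - k) * gaussBinom q ((p - p' - k) + (p' - v')) (p - u - k) := by
      by_cases h : v' ≤ u
      · rw [rowWeight, if_pos (by omega), show p - k - u = p - u - k by omega,
          show p - k - v' = (p - p' - k) + (p' - v') by omega]
      · rw [rowWeight_of_not (by omega), gaussBinom_of_lt (by omega), mul_zero]
    rw [e1, e2, gaussBinom_add hq, show p - (p - k) = k by omega, Finset.mul_sum, Finset.mul_sum,
      Finset.mul_sum]
    refine Finset.sum_congr rfl fun r hr => ?_
    have hr := Finset.mem_range.1 hr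
    rw [show p - u - k - r = p - u - r - k by omega,
      show p - p' - k - (p - u - r - k) = p - p' - (p - u - r) by omega,
      show p - u - k = p - u - r - k + r by omega, pow_add, pow_add]
    ring
  rw [Finset.sum_congr rfl h2]
  rw [Finset.sum_comm' (t' := Finset.range (p - u + 1))
    (s' := fun r => Finset.range (p - u - r + 1))]
  · refine Finset.sum_congr rfl fun r _ => ?_
    rw [momentCoeff, Finset.mul_sum, Finset.sum_mul]
  · intro k r
    simp only [Finset.mem_range]
    omega

/-- The sum of the weights of the chains `lam ⊇ ν ⊇ μ` of partitions with rows `0, …, R - 1`, over all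
`ν` with parts at most `n` and a given first row `v = ν_0`. For `R = 0` the first row is the empty
one. -/
def chainWeight (q x y : ℂ) (n : ℕ) : ℕ → (ℕ → ℕ) → (ℕ → ℕ) → ℕ → ℂ
  | 0, _, _, v => if v = 0 then 1 else 0
  | R + 1, lam, μ, v => rowWeight q x (lam 0) (lam 1) v *
      ∑ v' ∈ Finset.range (n + 1), rowWeight q y v v' (μ 0) *
        chainWeight q x y n R (fun i => lam (i + 1)) (fun i => μ (i + 1)) v'

theorem chainWeight_eq_zero (q x y : ℂ) (n R : ℕ) (lam μ : ℕ → ℕ) {v : ℕ} (hv : lam 0 < v) :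
    chainWeight q x y n R lam μ v = 0 := by
  cases R with
  | zero => rw [chainWeight, if_neg (by omega)]
  | succ R => rw [chainWeight, rowWeight_of_not (by omega), zero_mul]

/-- All `q`-binomial moments of the first row of the intermediate partition are unchanged when the
two variables are exchanged, although its individual weights are not. This is the form of the
commutation of two one-variable operators that can be proved by adding one row at a time. -/
theorem chainWeight_moment_comm {q : ℂ} (hq : ∀ k : ℕ, 0 < k → q ^ k ≠ 1) (x y : ℂ) (n R : ℕ)
    (lam μ : ℕ → ℕ) (hlam : Antitone lam) (h0 : lam R = 0) (hn : lam 0 ≤ n) (l : ℕ) :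
    ∑ v ∈ Finset.range (n + 1),
        gaussBinom q (lam 0 - v) l * y ^ l * chainWeight q x y n R lam μ v =
      ∑ v ∈ Finset.range (n + 1),
        gaussBinom q (lam 0 - v) l * x ^ l * chainWeight q y x n R lam μ v := by
  induction R generalizing lam μ l with
  | zero =>
    refine Finset.sum_congr rfl fun v _ => ?_
    rw [h0, Nat.zero_sub, chainWeight, chainWeight]
    cases l with
    | zero => simp
    | succ l => simp [gaussBinom_of_lt (q := q) (m := 0) (k := l + 1) (by omega)]
  | succ R ih =>
    by_cases hu : μ 0 ≤ lam 0
    swap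
    · have : ∀ x y : ℂ, ∀ v, chainWeight q x y n (R + 1) lam μ v = 0 := by
        intro x y v
        rw [chainWeight]
        by_cases hv : v ≤ lam 0
        · rw [Finset.sum_eq_zero, mul_zero]
          intro v' _
          rw [rowWeight_of_not (by omega), zero_mul]
        · rw [rowWeight_of_not (by omega), zero_mul]
      simp [this]
    have h1 : lam 1 ≤ lam 0 := hlam (Nat.zero_le 1)
    have key : ∀ x y : ℂ, ∑ v ∈ Finset.range (n + 1),
        gaussBinom q (lam 0 - v) l * y ^ l * chainWeight q x y n (R + 1) lam μ v =
        ∑ r ∈ Finset.range (lam 0 - μ 0 + 1),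
          q ^ (r * (lam 0 - lam 1 - (lam 0 - μ 0 - r))) *
          momentCoeff q x y (lam 0 - lam 1) (lam 0 - μ 0 - r) l *
          ∑ v' ∈ Finset.range (n + 1), gaussBinom q (lam 1 - v') r * y ^ r *
            chainWeight q x y n R (fun i => lam (i + 1)) (fun i => μ (i + 1)) v' := by
      intro x y
      simp only [chainWeight, Finset.mul_sum]
      rw [Finset.sum_comm]
      conv_rhs => rw [Finset.sum_comm]
      refine Finset.sum_congr rfl fun v' _ => ?_
      by_cases hv : v' ≤ lam 1
      · have := congrArg
          (· * chainWeight q x y n R (fun i => lam (i + 1)) (fun i => μ (i + 1)) v')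
          (sum_rowWeight_mul_rowWeight hq x y hv h1 hn hu l)
        simp only [Finset.sum_mul] at this
        convert this using 2
        · ring
        · ring
      · have := chainWeight_eq_zero q x y n R (fun i => lam (i + 1)) (fun i => μ (i + 1))
          (v := v') (by simpa using hv)
        simp [this]
    rw [key x y, key y x]
    refine Finset.sum_congr rfl fun r _ => ?_
    rw [momentCoeff_comm hq x y]
    congr 1
    exact ih (fun i => lam (i + 1)) (fun i => μ (i + 1))
      (fun i j hij => hlam (Nat.add_le_add_right hij 1)) h0 (h1.trans hn) r

theorem sum_chainWeight_comm {q : ℂ} (hq : ∀ k : ℕ, 0 < k → q ^ k ≠ 1) (x y : ℂ) (n R : ℕ)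
    (lam μ : ℕ → ℕ) (hlam : Antitone lam) (h0 : lam R = 0) (hn : lam 0 ≤ n) :
    ∑ v ∈ Finset.range (n + 1), chainWeight q x y n R lam μ v =
      ∑ v ∈ Finset.range (n + 1), chainWeight q y x n R lam μ v := by
  simpa [gaussBinom_zero_right hq] using chainWeight_moment_comm hq x y n R lam μ hlam h0 hn 0

/-! ### Partitions in a box and the symmetry of skew `q`-Whittaker polynomials -/

theorem rowLen_eq_zero {ν : YoungDiagram} {R i : ℕ} (hR : ν.colLen 0 ≤ R) (hi : R ≤ i) :
    ν.rowLen i = 0 := by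
  by_contra h
  have : (i, 0) ∈ ν := YoungDiagram.mem_iff_lt_rowLen.2 (Nat.pos_of_ne_zero h)
  have := YoungDiagram.mem_iff_lt_colLen.1 this
  omega

theorem colLen_zero_le_of_rowLen_eq_zero {ν : YoungDiagram} {R : ℕ} (h : ν.rowLen R = 0) :
    ν.colLen 0 ≤ R := by
  by_contra! hlt
  have := YoungDiagram.mem_iff_lt_rowLen.1 (YoungDiagram.mem_iff_lt_colLen.2 hlt)
  omega

theorem rowLen_mono {ν lam : YoungDiagram} (h : ν ≤ lam) (i : ℕ) : ν.rowLen i ≤ lam.rowLen i := by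
  by_contra! hlt
  have := YoungDiagram.mem_iff_lt_rowLen.1 (h (YoungDiagram.mem_iff_lt_rowLen.2 hlt))
  omega

theorem le_of_rowLen_le {ν lam : YoungDiagram} (h : ∀ i, ν.rowLen i ≤ lam.rowLen i) : ν ≤ lam := by
  rintro ⟨i, j⟩ hij
  exact YoungDiagram.mem_iff_lt_rowLen.2 ((YoungDiagram.mem_iff_lt_rowLen.1 hij).trans_le (h i))

theorem colLen_mono {ν lam : YoungDiagram} (h : ν ≤ lam) (j : ℕ) : ν.colLen j ≤ lam.colLen j := by
  have := rowLen_mono (YoungDiagram.transpose_mono h) j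
  simpa using this

theorem eq_of_rowLen_eq {ν lam : YoungDiagram} (h : ∀ i, ν.rowLen i = lam.rowLen i) : ν = lam :=
  le_antisymm (le_of_rowLen_le fun i => (h i).le) (le_of_rowLen_le fun i => (h i).ge)

theorem mem_subdiagrams {ν lam : YoungDiagram} : ν ∈ subdiagrams lam ↔ ν ≤ lam := by
  simp [subdiagrams]

theorem transpose_card (ν : YoungDiagram) : ν.transpose.card = ν.card := by
  rw [YoungDiagram.card, YoungDiagram.card, YoungDiagram.transpose]
  simp

theorem card_eq_sum_rowLen {ν : YoungDiagram} {R : ℕ} (hR : ν.colLen 0 ≤ R) :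
    ν.card = ∑ i ∈ Finset.range R, ν.rowLen i := by
  have h1 := card_eq_sum_colLen ν.transpose
  simp only [YoungDiagram.colLen_transpose, YoungDiagram.rowLen_transpose] at h1
  rw [← transpose_card, h1]
  refine Finset.sum_subset (Finset.range_mono hR) fun i _ hi => ?_
  exact rowLen_eq_zero le_rfl (by simpa using hi)

theorem exists_rowLen_eq {f : ℕ → ℕ} (hf : Antitone f) {R : ℕ} (hR : f R = 0) :
    ∃ ν : YoungDiagram, ν.rowLen = f := by
  refine ⟨⟨((Finset.range R) ×ˢ (Finset.range (f 0))).filter fun c => c.2 < f c.1, ?_⟩, ?_⟩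
  · rintro ⟨i, j⟩ ⟨i', j'⟩ ⟨hi, hj⟩ h
    simp only [Finset.coe_filter, Finset.mem_product, Finset.mem_range, Set.mem_ofPred_eq]
      at h hi hj ⊢
    have := hf hi
    have := hf (Nat.zero_le i')
    omega
  · funext i
    refine eq_of_forall_lt_iff fun j => ?_
    rw [← YoungDiagram.mem_iff_lt_rowLen, ← YoungDiagram.mem_cells]
    simp only [Finset.mem_filter, Finset.mem_product, Finset.mem_range]
    refine ⟨fun h => h.2, fun h => ⟨⟨?_, h.trans_le (hf (Nat.zero_le i))⟩, h⟩⟩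
    by_contra! hle
    have := hf hle
    omega

theorem finite_box (n R : ℕ) : {ν : YoungDiagram | ν.rowLen 0 ≤ n ∧ ν.colLen 0 ≤ R}.Finite := by
  obtain ⟨rect, hrect⟩ := exists_rowLen_eq (f := fun i => if i < R then n else 0) (R := R)
    (fun i j hij => by dsimp only; split_ifs <;> omega) (by simp)
  refine (finite_subdiagrams rect).subset ?_
  rintro ν ⟨h1, h2⟩
  refine le_of_rowLen_le fun i => ?_
  rw [hrect]
  dsimp only
  split_ifs with hi
  · exact (ν.rowLen_anti 0 i i.zero_le).trans h1
  · exact (rowLen_eq_zero h2 (by omega)).le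

/-- The finite set of partitions with at most `R` parts, all of them at most `n`. -/
def box (n R : ℕ) : Finset YoungDiagram :=
  (finite_box n R).toFinset

theorem mem_box {n R : ℕ} {ν : YoungDiagram} :
    ν ∈ box n R ↔ ν.rowLen 0 ≤ n ∧ ν.colLen 0 ≤ R := by
  simp [box]

theorem mem_box_of_le {n R : ℕ} {ν lam : YoungDiagram} (h : ν ≤ lam) (hl : lam ∈ box n R) :
    ν ∈ box n R :=
  mem_box.2 ⟨(rowLen_mono h 0).trans (mem_box.1 hl).1, (colLen_mono h 0).trans (mem_box.1 hl).2⟩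

/-- Extension of a finite sequence by zeros. -/
def extendZero {R : ℕ} (f : Fin R → ℕ) (i : ℕ) : ℕ :=
  if h : i < R then f ⟨i, h⟩ else 0

theorem extendZero_of_le {R : ℕ} (f : Fin R → ℕ) {i : ℕ} (h : R ≤ i) : extendZero f i = 0 :=
  dif_neg (by omega)

theorem extendZero_val {R : ℕ} (f : Fin R → ℕ) (i : Fin R) : extendZero f i = f i :=
  dif_pos i.2

theorem extendZero_cons_zero {R : ℕ} (v : ℕ) (f : Fin R → ℕ) :
    extendZero (Fin.cons v f : Fin (R + 1) → ℕ) 0 = v := by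
  simp [extendZero]

theorem extendZero_cons_succ {R : ℕ} (v : ℕ) (f : Fin R → ℕ) (i : ℕ) :
    extendZero (Fin.cons v f : Fin (R + 1) → ℕ) (i + 1) = extendZero f i := by
  by_cases h : i < R
  · rw [extendZero, extendZero, dif_pos h, dif_pos (by omega)]
    exact Fin.cons_succ (α := fun _ => ℕ) v f ⟨i, h⟩
  · rw [extendZero_of_le _ (by omega), extendZero_of_le _ (by omega)]

theorem extendZero_rowLen {ν : YoungDiagram} {R : ℕ} (hR : ν.colLen 0 ≤ R) :
    extendZero (fun i : Fin R => ν.rowLen i) = ν.rowLen := by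
  funext i
  by_cases h : i < R
  · rw [extendZero, dif_pos h]
  · rw [extendZero_of_le _ (by omega), rowLen_eq_zero hR (by omega)]

/-- A sum over partitions in a box is a sum over all sequences of row lengths, if the summand
vanishes on the sequences that are not decreasing. -/
theorem sum_box (n R : ℕ) (F : (ℕ → ℕ) → ℂ)
    (hF : ∀ f, (∀ i, R ≤ i → f i = 0) → ¬Antitone f → F f = 0) :
    ∑ ν ∈ box n R, F ν.rowLen =
      ∑ f ∈ Fintype.piFinset (fun _ : Fin R => Finset.range (n + 1)), F (extendZero f) := by
  refine Finset.sum_of_injOn (fun ν i => ν.rowLen i) ?_ ?_ ?_ ?_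
  · intro ν hν κ hκ h
    have h1 := extendZero_rowLen (mem_box.1 (Finset.mem_coe.1 hν)).2
    have h2 := extendZero_rowLen (mem_box.1 (Finset.mem_coe.1 hκ)).2
    refine eq_of_rowLen_eq fun i => ?_
    rw [← h1, ← h2]
    exact congrFun (congrArg extendZero h) i
  · intro ν hν
    refine Finset.mem_coe.2 (Fintype.mem_piFinset.2 fun i => Finset.mem_range.2 ?_)
    change ν.rowLen i < n + 1
    have := ν.rowLen_anti 0 i (Nat.zero_le _)
    have := (mem_box.1 (Finset.mem_coe.1 hν)).1
    omega
  · intro f hf hnot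
    refine hF _ (fun i hi => extendZero_of_le f hi) fun hanti => hnot ?_
    obtain ⟨ν, hν⟩ := exists_rowLen_eq hanti (extendZero_of_le f le_rfl)
    have hR : ν.colLen 0 ≤ R :=
      colLen_zero_le_of_rowLen_eq_zero (by rw [hν]; exact extendZero_of_le f le_rfl)
    refine ⟨ν, Finset.mem_coe.2 (mem_box.2 ⟨?_, hR⟩), ?_⟩
    · rw [hν]
      by_cases h : 0 < R
      · have := Finset.mem_range.1 (Fintype.mem_piFinset.1 hf ⟨0, h⟩)
        rw [extendZero, dif_pos h]
        omega
      · rw [extendZero_of_le _ (by omega)]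
        omega
    · funext i
      change ν.rowLen i = f i
      rw [hν, extendZero_val]
  · intro ν hν
    rw [extendZero_rowLen (mem_box.1 hν).2]

theorem sum_piFinset_succ (R : ℕ) (s : Finset ℕ) (F : (Fin (R + 1) → ℕ) → ℂ) :
    ∑ f ∈ Fintype.piFinset (fun _ : Fin (R + 1) => s), F f =
      ∑ v ∈ s, ∑ f ∈ Fintype.piFinset (fun _ : Fin R => s), F (Fin.cons v f) := by
  rw [← Finset.sum_product']
  symm
  refine Finset.sum_nbij' (fun p => Fin.cons p.1 p.2) (fun f => (f 0, Fin.tail f)) ?_ ?_ ?_ ?_ ?_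
  · rintro ⟨v, f⟩ h
    simpa [Fintype.mem_piFinset, Fin.forall_fin_succ] using h
  · intro f h
    simpa [Fintype.mem_piFinset, Fin.forall_fin_succ, Fin.tail] using h
  · rintro ⟨v, f⟩ _
    simp
  · intro f _
    simp
  · intros
    rfl

theorem isHorizontalStrip_le {lam ν : YoungDiagram} (h : IsHorizontalStrip lam ν) : ν ≤ lam :=
  le_of_rowLen_le fun i => (h i).1

theorem isHorizontalStrip_of_whittakerOne_ne_zero {q x : ℂ} {lam ν : YoungDiagram}
    (h : whittakerOne q x lam ν ≠ 0) : IsHorizontalStrip lam ν := by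
  by_contra h'
  exact h (if_neg h')

theorem card_sub_card {lam ν : YoungDiagram} (h : IsHorizontalStrip lam ν) {R : ℕ}
    (hR : lam.colLen 0 ≤ R) :
    lam.card - ν.card = ∑ i ∈ Finset.range R, (lam.rowLen i - ν.rowLen i) := by
  rw [card_eq_sum_rowLen hR,
    card_eq_sum_rowLen ((colLen_mono (isHorizontalStrip_le h) 0).trans hR),
    Finset.sum_tsub_distrib _ fun i _ => (h i).1]

theorem whittakerOne_eq_prod (q x : ℂ) {lam ν : YoungDiagram} {R : ℕ} (hlam : lam.colLen 0 ≤ R)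
    (hν : ν.colLen 0 ≤ R) :
    whittakerOne q x lam ν =
      ∏ i ∈ Finset.range R, rowWeight q x (lam.rowLen i) (lam.rowLen (i + 1)) (ν.rowLen i) := by
  by_cases h : IsHorizontalStrip lam ν
  · rw [whittakerOne, if_pos h, card_sub_card h hlam, ← Finset.prod_pow_eq_pow_sum]
    have h1 : ∏ i ∈ Finset.range (lam.colLen 0),
        qPoch q (lam.rowLen i - lam.rowLen (i + 1)) /
          (qPoch q (lam.rowLen i - ν.rowLen i) * qPoch q (ν.rowLen i - lam.rowLen (i + 1))) =
        ∏ i ∈ Finset.range R, qPoch q (lam.rowLen i - lam.rowLen (i + 1)) /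
          (qPoch q (lam.rowLen i - ν.rowLen i) * qPoch q (ν.rowLen i - lam.rowLen (i + 1))) := by
      refine Finset.prod_subset (Finset.range_mono hlam) fun i _ hi => ?_
      have h0 : lam.rowLen i = 0 := rowLen_eq_zero le_rfl (by simpa using hi)
      have := (h i).1
      simp [h0, show ν.rowLen i = 0 by omega, qPoch_zero]
    rw [h1, ← Finset.prod_mul_distrib]
    refine Finset.prod_congr rfl fun i _ => ?_
    have hi := h i
    rw [rowWeight, if_pos ⟨hi.2, hi.1⟩, gaussBinom_of_le (by omega),
      show lam.rowLen i - lam.rowLen (i + 1) - (lam.rowLen i - ν.rowLen i) =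
        ν.rowLen i - lam.rowLen (i + 1) by omega]
  · rw [whittakerOne, if_neg h]
    rw [IsHorizontalStrip] at h
    push Not at h
    obtain ⟨i, hi⟩ := h
    have hiR : i < R := by
      by_contra! hle
      have := rowLen_eq_zero hlam hle
      have := rowLen_eq_zero hν hle
      have := rowLen_eq_zero hlam (show R ≤ i + 1 by omega)
      omega
    symm
    refine Finset.prod_eq_zero (Finset.mem_range.2 hiR) (rowWeight_of_not ?_)
    omega

theorem sum_mul_chainWeight (q x y : ℂ) (n R : ℕ) (lam μ : ℕ → ℕ) (g : ℕ → ℂ) :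
    ∑ v ∈ Finset.range (n + 1), g v * chainWeight q x y n R lam μ v =
      ∑ f ∈ Fintype.piFinset (fun _ : Fin R => Finset.range (n + 1)), g (extendZero f 0) *
        ∏ i ∈ Finset.range R, (rowWeight q x (lam i) (lam (i + 1)) (extendZero f i) *
          rowWeight q y (extendZero f i) (extendZero f (i + 1)) (μ i)) := by
  induction R generalizing lam μ g with
  | zero =>
    simp [chainWeight, extendZero]
  | succ R ih =>
    rw [sum_piFinset_succ]
    refine Finset.sum_congr rfl fun v _ => ?_
    rw [chainWeight, ih, Finset.mul_sum, Finset.mul_sum]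
    refine Finset.sum_congr rfl fun f _ => ?_
    rw [Finset.prod_range_succ']
    simp only [extendZero_cons_succ, extendZero_cons_zero, zero_add]
    ring

theorem sum_subdiagrams_eq_sum_box {n R : ℕ} {lam : YoungDiagram} (h : lam ∈ box n R)
    (F : YoungDiagram → ℂ) (hF : ∀ ν, ¬ν ≤ lam → F ν = 0) :
    ∑ ν ∈ subdiagrams lam, F ν = ∑ ν ∈ box n R, F ν :=
  Finset.sum_subset (fun _ hν => mem_box_of_le (mem_subdiagrams.1 hν) h)
    fun ν _ hν => hF ν fun h' => hν (mem_subdiagrams.2 h')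

theorem whittakerOne_eq_zero {q x : ℂ} {lam ν : YoungDiagram} (h : ¬ν ≤ lam) :
    whittakerOne q x lam ν = 0 :=
  if_neg fun h' => h (isHorizontalStrip_le h')

/-- The two-variable skew `q`-Whittaker polynomials are symmetric. -/
theorem sum_whittakerOne_comm {q : ℂ} (hq : ∀ k : ℕ, 0 < k → q ^ k ≠ 1) (x y : ℂ)
    (lam μ : YoungDiagram) :
    ∑ ν ∈ subdiagrams lam, whittakerOne q x lam ν * whittakerOne q y ν μ =
      ∑ ν ∈ subdiagrams lam, whittakerOne q y lam ν * whittakerOne q x ν μ := by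
  by_cases hμ : μ ≤ lam
  swap
  · have : ∀ x y : ℂ, ∀ ν ∈ subdiagrams lam, whittakerOne q x lam ν * whittakerOne q y ν μ = 0 := by
      intro x y ν hν
      rw [whittakerOne_eq_zero (lam := ν) (ν := μ) fun h => hμ (h.trans (mem_subdiagrams.1 hν)),
        mul_zero]
    rw [Finset.sum_eq_zero (this x y), Finset.sum_eq_zero (this y x)]
  have hlam : lam ∈ box (lam.rowLen 0) (lam.colLen 0) := mem_box.2 ⟨le_rfl, le_rfl⟩
  have key : ∀ x y : ℂ,
      ∑ ν ∈ subdiagrams lam, whittakerOne q x lam ν * whittakerOne q y ν μ =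
        ∑ v ∈ Finset.range (lam.rowLen 0 + 1),
          chainWeight q x y (lam.rowLen 0) (lam.colLen 0) lam.rowLen μ.rowLen v := by
    intro x y
    rw [sum_subdiagrams_eq_sum_box hlam]
    swap
    · intro ν hν
      rw [whittakerOne_eq_zero hν, zero_mul]
    have h1 := sum_mul_chainWeight q x y (lam.rowLen 0) (lam.colLen 0) lam.rowLen μ.rowLen
      (fun _ => 1)
    simp only [one_mul] at h1
    rw [h1]
    refine Eq.trans (Finset.sum_congr rfl fun ν hν => ?_)
      (sum_box (lam.rowLen 0) (lam.colLen 0) (fun f => ∏ i ∈ Finset.range (lam.colLen 0),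
        (rowWeight q x (lam.rowLen i) (lam.rowLen (i + 1)) (f i) *
          rowWeight q y (f i) (f (i + 1)) (μ.rowLen i))) fun f h0 hf => ?_)
    · have hν' := (mem_box.1 hν).2
      rw [Finset.prod_mul_distrib, ← whittakerOne_eq_prod q x le_rfl hν',
        ← whittakerOne_eq_prod q y hν' (colLen_mono hμ 0)]
    · have : ∃ i, f i < f (i + 1) := by
        by_contra! h
        exact hf (antitone_nat_of_succ_le h)
      obtain ⟨i, hi⟩ := this
      have hiR : i < lam.colLen 0 := by
        by_contra! hle
        have := h0 (i + 1) (by omega)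
        omega
      refine Finset.prod_eq_zero (Finset.mem_range.2 hiR) ?_
      rw [rowWeight_of_not (p := f i) (by omega), mul_zero]
  rw [key, key]
  exact sum_chainWeight_comm hq x y _ _ _ _ (fun i j h => lam.rowLen_anti i j h)
    (rowLen_eq_zero le_rfl le_rfl) le_rfl

/-! ### The left boundary weight -/

theorem qBinom_symm (q : ℂ) {m k : ℕ} (hk : k ≤ m) : qBinom q m (m - k) = qBinom q m k := by
  rw [qBinom, qBinom, Nat.sub_sub_self hk, mul_comm (qPoch q k)]

theorem rogersSzegoHom_comm (q : ℂ) (m : ℕ) (a b : ℂ) :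
    rogersSzegoHom q m a b = rogersSzegoHom q m b a := by
  unfold rogersSzegoHom
  rw [← Finset.sum_range_reflect]
  refine Finset.sum_congr rfl fun k hk => ?_
  have hk' : k ≤ m := Nat.lt_succ_iff.mp (Finset.mem_range.mp hk)
  rw [Nat.add_sub_cancel, qBinom_symm q hk', Nat.sub_sub_self hk']
  ring

theorem rogersSzegoHom_inv (q : ℂ) (m : ℕ) {a b : ℂ} (ha : a ≠ 0) (hb : b ≠ 0) :
    rogersSzegoHom q m a⁻¹ b⁻¹ = (a * b)⁻¹ ^ m * rogersSzegoHom q m a b := by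
  rw [rogersSzegoHom_comm q m a b]
  unfold rogersSzegoHom
  rw [Finset.mul_sum]
  refine Finset.sum_congr rfl fun k hk => ?_
  obtain ⟨j, rfl⟩ := Nat.exists_eq_add_of_le (Nat.lt_succ_iff.mp (Finset.mem_range.mp hk))
  rw [Nat.add_sub_cancel_left, inv_pow, inv_pow, inv_pow, mul_pow, pow_add, pow_add]
  field_simp

theorem rogersSzego_eq_hom (q : ℂ) (m : ℕ) (z : ℂ) :
    rogersSzego q m z = rogersSzegoHom q m 1 z := by
  rw [rogersSzegoHom_eq q m one_ne_zero, one_pow, one_mul, div_one]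

theorem rogersSzegoHom_zero_left (q a b : ℂ) : rogersSzegoHom q 0 a b = 1 := by
  simp [rogersSzegoHom, qBinom, qPoch_zero]

theorem rogersSzegoHom_zero_right {q : ℂ} (hq : ∀ k : ℕ, 0 < k → q ^ k ≠ 1) (m : ℕ) (a : ℂ) :
    rogersSzegoHom q m a 0 = a ^ m := by
  unfold rogersSzegoHom
  rw [Finset.sum_eq_single 0]
  · simp [qBinom, qPoch_zero, div_self (qPoch_ne_zero hq m)]
  · intro k _ hk
    simp [hk]
  · simp

/-- The coefficient of `P_{lam/μ}` and of the right boundary polynomial in `Z_n`, i.e. the left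
boundary weight of the partition `lam`. -/
def leftWeight (n : ℕ) (q a b : ℂ) (lam : YoungDiagram) : ℂ :=
  rogersSzego q (n - lam.rowLen 0) (a * b) * hPoly q a b lam.transpose /
    (qPoch q (n - lam.rowLen 0) *
      ∏ i ∈ Finset.range (lam.colLen 0), qPoch q (lam.rowLen i - lam.rowLen (i + 1)))

/-- The sequence of row lengths with an additional initial row of length `n`. The multiplicity
`n - lam_1` of the reservoir thus becomes one more difference of consecutive rows. -/
def consRow (n : ℕ) (f : ℕ → ℕ) : ℕ → ℕ
  | 0 => n
  | i + 1 => f i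

/-- The factor of the left boundary weight that belongs to a difference `m` of the consecutive rows
`i`, `i + 1` in the extended sequence `consRow`. -/
def leftFactor (q a b : ℂ) (i m : ℕ) : ℂ :=
  (if Even i then rogersSzegoHom q m 1 (a * b) else rogersSzegoHom q m a b) / qPoch q m

theorem leftFactor_zero (q a b : ℂ) (i : ℕ) : leftFactor q a b i 0 = 1 := by
  simp [leftFactor, rogersSzegoHom_zero_left, qPoch_zero]

theorem leftWeight_eq_prod (n : ℕ) (q a b : ℂ) {lam : YoungDiagram} {R : ℕ}
    (hR : lam.colLen 0 ≤ R) :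
    leftWeight n q a b lam = ∏ i ∈ Finset.range (R + 1),
      leftFactor q a b i (consRow n lam.rowLen i - consRow n lam.rowLen (i + 1)) := by
  rw [Finset.prod_range_succ', leftWeight, hPoly, YoungDiagram.rowLen_transpose, mul_div_mul_comm,
    ← Finset.prod_div_distrib, mul_comm, rogersSzego_eq_hom]
  congr 1
  · refine Eq.trans (Finset.prod_congr rfl fun i _ => ?_)
      (Finset.prod_subset (Finset.range_mono hR) fun i _ hi => ?_)
    · rw [leftFactor, mult, YoungDiagram.colLen_transpose, YoungDiagram.colLen_transpose,
        consRow, consRow, rogersSzego_eq_hom]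
      by_cases h : Even i
      · rw [if_pos h, if_neg (by simpa [Nat.even_add_one] using h)]
      · rw [if_neg h, if_pos (by simpa [Nat.even_add_one] using h)]
    · have hi : lam.colLen 0 ≤ i := by simpa using hi
      rw [consRow, rowLen_eq_zero le_rfl hi, Nat.zero_sub, leftFactor_zero]

theorem leftWeight_comm (n : ℕ) (q a b : ℂ) (lam : YoungDiagram) :
    leftWeight n q a b lam = leftWeight n q b a lam := by
  rw [leftWeight_eq_prod n q a b le_rfl, leftWeight_eq_prod n q b a le_rfl]
  simp only [leftFactor, mul_comm a b, rogersSzegoHom_comm q _ a b]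

theorem leftFactor_inv (q : ℂ) {a b : ℂ} (ha : a ≠ 0) (hb : b ≠ 0) (i m : ℕ) :
    leftFactor q a⁻¹ b⁻¹ i m = (a * b)⁻¹ ^ m * leftFactor q a b i m := by
  have h := rogersSzegoHom_inv q m one_ne_zero (mul_ne_zero ha hb)
  rw [one_mul, inv_one, mul_inv] at h
  rw [leftFactor, leftFactor, h, rogersSzegoHom_inv q m ha hb, mul_inv]
  split_ifs <;> ring

theorem sum_consRow_sub {n : ℕ} {lam : YoungDiagram} (hn : lam.rowLen 0 ≤ n) (k : ℕ) :
    ∑ i ∈ Finset.range (k + 1), (consRow n lam.rowLen i - consRow n lam.rowLen (i + 1)) =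
      n - lam.rowLen k := by
  induction k with
  | zero => simp [consRow]
  | succ k ih =>
    rw [Finset.sum_range_succ, ih, consRow, consRow]
    have := lam.rowLen_anti k (k + 1) k.le_succ
    have := lam.rowLen_anti 0 k k.zero_le
    omega

/-- The left boundary weight is homogeneous under the simultaneous inversion of both parameters:
the differences of consecutive rows, including the reservoir, add up to `n`. -/
theorem leftWeight_inv {n : ℕ} (q : ℂ) {a b : ℂ} (ha : a ≠ 0) (hb : b ≠ 0) {lam : YoungDiagram}
    (hn : lam.rowLen 0 ≤ n) :
    leftWeight n q a⁻¹ b⁻¹ lam = (a * b)⁻¹ ^ n * leftWeight n q a b lam := by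
  rw [leftWeight_eq_prod n q a b le_rfl, leftWeight_eq_prod n q a⁻¹ b⁻¹ le_rfl]
  simp only [leftFactor_inv q ha hb]
  rw [Finset.prod_mul_distrib, Finset.prod_pow_eq_pow_sum, sum_consRow_sub hn,
    rowLen_eq_zero le_rfl le_rfl, Nat.sub_zero]

/-- The contribution of the row length `v = lam_i` to the product of the left boundary weight with
parameters `a, 0` and `P_{lam/μ}(b;q,0)`, regrouped by rows of `lam`; here `p = μ_{i-1}`
(`p = n` for the first row) and `u = μ_i`. -/
def splitFactor (q a b : ℂ) (i p u v : ℕ) : ℂ :=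
  if u ≤ v ∧ v ≤ p then
    (if Even i then (a * b) ^ (v - u) else a ^ (p - v) * b ^ (v - u)) /
      (qPoch q (v - u) * qPoch q (p - v))
  else 0

theorem sum_splitFactor {q : ℂ} (hq : ∀ k : ℕ, 0 < k → q ^ k ≠ 1) (a b : ℂ) (i : ℕ) {n p u : ℕ}
    (hup : u ≤ p) (hp : p ≤ n) :
    ∑ v ∈ Finset.range (n + 1), splitFactor q a b i p u v = leftFactor q a b i (p - u) := by
  have h1 : ∑ v ∈ Finset.range (n + 1), splitFactor q a b i p u v =
      ∑ v ∈ Finset.Ico u (p + 1), splitFactor q a b i p u v := by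
    symm
    refine Finset.sum_subset (fun v hv => ?_) fun v _ hv => if_neg ?_
    · rw [Finset.mem_Ico] at hv
      rw [Finset.mem_range]
      omega
    · rw [Finset.mem_Ico] at hv
      omega
  have h2 : ∀ k ∈ Finset.range (p - u + 1), splitFactor q a b i p u (u + k) =
      (if Even i then qBinom q (p - u) k * 1 ^ (p - u - k) * (a * b) ^ k
        else qBinom q (p - u) k * a ^ (p - u - k) * b ^ k) / qPoch q (p - u) := by
    intro k hk
    have hk := Finset.mem_range.1 hk
    rw [splitFactor, if_pos (by omega), Nat.add_sub_cancel_left,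
      show p - (u + k) = p - u - k by omega, qBinom]
    have := qPoch_ne_zero hq (p - u)
    have := qPoch_ne_zero hq k
    have := qPoch_ne_zero hq (p - u - k)
    split_ifs
    · rw [one_pow]
      field_simp
    · field_simp
  rw [h1, Finset.sum_Ico_eq_sum_range, show p + 1 - u = p - u + 1 by omega,
    Finset.sum_congr rfl h2, ← Finset.sum_div, leftFactor, rogersSzegoHom, rogersSzegoHom]
  split_ifs <;> rfl

theorem leftWeight_mul_whittakerOne {q : ℂ} (hq : ∀ k : ℕ, 0 < k → q ^ k ≠ 1) (a b : ℂ) {n R : ℕ}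
    {lam μ : YoungDiagram} (hlam : lam ∈ box n (R + 1)) (hμ : μ.colLen 0 ≤ R) :
    leftWeight n q a 0 lam * whittakerOne q b lam μ = ∏ i ∈ Finset.range (R + 1),
      splitFactor q a b i (consRow n μ.rowLen i) (μ.rowLen i) (lam.rowLen i) := by
  obtain ⟨hn, hR⟩ := mem_box.1 hlam
  by_cases h : IsHorizontalStrip lam μ
  swap
  · rw [whittakerOne, if_neg h, mul_zero]
    rw [IsHorizontalStrip] at h
    push Not at h
    obtain ⟨i, hi⟩ := h
    symm
    by_cases h1 : μ.rowLen i ≤ lam.rowLen i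
    · have hi := hi h1
      have hiR : i < R := by
        by_contra! hle
        have := rowLen_eq_zero hR (show R + 1 ≤ i + 1 by omega)
        omega
      refine Finset.prod_eq_zero (i := i + 1) (Finset.mem_range.2 (by omega)) (if_neg ?_)
      rw [consRow]
      omega
    · have hiR : i < R := by
        by_contra! hle
        have := rowLen_eq_zero hμ hle
        omega
      exact Finset.prod_eq_zero (i := i) (Finset.mem_range.2 (by omega)) (if_neg (by omega))
  -- The pairs `(lam_i, μ_i)` and `(μ_i, lam_{i+1})` contribute separately.
  set A : ℕ → ℂ := fun i => (if Even i then a ^ (lam.rowLen i - μ.rowLen i) else 1) *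
    b ^ (lam.rowLen i - μ.rowLen i) / qPoch q (lam.rowLen i - μ.rowLen i) with hA
  set B : ℕ → ℂ := fun i => (if Even i then 1 else a ^ (consRow n μ.rowLen i - lam.rowLen i)) /
    qPoch q (consRow n μ.rowLen i - lam.rowLen i) with hB
  have e1 : ∀ i ∈ Finset.range (R + 1),
      leftFactor q a 0 (i + 1) (lam.rowLen i - lam.rowLen (i + 1)) *
        rowWeight q b (lam.rowLen i) (lam.rowLen (i + 1)) (μ.rowLen i) = A i * B (i + 1) := by
    intro i _
    obtain ⟨h1, h2⟩ := h i
    have hm : lam.rowLen i - lam.rowLen (i + 1) =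
        (lam.rowLen i - μ.rowLen i) + (μ.rowLen i - lam.rowLen (i + 1)) := by omega
    have := qPoch_ne_zero hq (lam.rowLen i - lam.rowLen (i + 1))
    have := qPoch_ne_zero hq (lam.rowLen i - μ.rowLen i)
    have := qPoch_ne_zero hq (μ.rowLen i - lam.rowLen (i + 1))
    have hw : rowWeight q b (lam.rowLen i) (lam.rowLen (i + 1)) (μ.rowLen i) = _ :=
      if_pos ⟨h2, h1⟩
    rw [leftFactor, hw, mul_zero, gaussBinom_of_le (by omega),
      show lam.rowLen i - lam.rowLen (i + 1) - (lam.rowLen i - μ.rowLen i) =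
        μ.rowLen i - lam.rowLen (i + 1) by omega]
    simp only [hA, hB, consRow, Nat.even_add_one, rogersSzegoHom_zero_right hq, one_pow]
    by_cases hi : Even i
    · simp only [hi, not_true_eq_false, if_true, if_false]
      nth_rewrite 1 [hm]
      rw [pow_add]
      field_simp
    · simp only [hi, not_false_eq_true, if_true, if_false]
      field_simp
  have e2 : ∀ i ∈ Finset.range (R + 1),
      splitFactor q a b i (consRow n μ.rowLen i) (μ.rowLen i) (lam.rowLen i) = A i * B i := by
    intro i _
    have hi : lam.rowLen i ≤ consRow n μ.rowLen i := by
      cases i with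
      | zero => exact hn
      | succ i => exact (h i).2
    rw [splitFactor, if_pos ⟨(h i).1, hi⟩]
    simp only [hA, hB]
    split_ifs
    · rw [mul_pow]
      ring
    · ring
  have e3 : B (R + 1) = 1 := by
    simp [hB, consRow, rowLen_eq_zero hμ le_rfl, qPoch_zero]
  have e4 : leftFactor q a 0 0 (consRow n lam.rowLen 0 - consRow n lam.rowLen (0 + 1)) = B 0 := by
    simp [hB, leftFactor, consRow, rogersSzegoHom_zero_right hq]
  rw [leftWeight_eq_prod n q a 0 hR, whittakerOne_eq_prod q b hR (hμ.trans R.le_succ),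
    Finset.prod_range_succ', e4, mul_right_comm, ← Finset.prod_mul_distrib,
    Finset.prod_congr rfl e2]
  simp only [consRow]
  rw [Finset.prod_congr rfl e1, Finset.prod_mul_distrib, Finset.prod_mul_distrib, mul_assoc,
    ← Finset.prod_range_succ' B, Finset.prod_range_succ B (R + 1), e3, mul_one]

/-- A left boundary with one vanishing parameter absorbs a variable as its second parameter. -/
theorem sum_leftWeight_mul_whittakerOne {q : ℂ} (hq : ∀ k : ℕ, 0 < k → q ^ k ≠ 1) (a b : ℂ)
    {n R : ℕ} {μ : YoungDiagram} (hμ : μ ∈ box n R) :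
    ∑ lam ∈ box n (R + 1), leftWeight n q a 0 lam * whittakerOne q b lam μ =
      leftWeight n q a b μ := by
  obtain ⟨hn, hR⟩ := mem_box.1 hμ
  rw [Finset.sum_congr rfl fun lam hlam => leftWeight_mul_whittakerOne hq a b hlam hR,
    sum_box n (R + 1) (fun f => ∏ i ∈ Finset.range (R + 1),
      splitFactor q a b i (consRow n μ.rowLen i) (μ.rowLen i) (f i))]
  · simp only [Finset.prod_range, extendZero_val]
    rw [← Finset.prod_univ_sum (fun _ => Finset.range (n + 1)) (fun (i : Fin (R + 1)) v =>
      splitFactor q a b i (consRow n μ.rowLen i) (μ.rowLen i) v), leftWeight_eq_prod n q a b hR,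
      Finset.prod_range]
    refine Finset.prod_congr rfl fun i _ => ?_
    have h0 := μ.rowLen_anti 0 i (Nat.zero_le _)
    obtain ⟨i, hi⟩ := i
    cases i with
    | zero => exact sum_splitFactor hq a b 0 hn le_rfl
    | succ i =>
      exact sum_splitFactor hq a b (i + 1) (μ.rowLen_anti i (i + 1) i.le_succ)
        ((μ.rowLen_anti 0 i i.zero_le).trans hn)
  · intro f h0 hf
    have : ∃ i, f i < f (i + 1) := by
      by_contra! h
      exact hf (antitone_nat_of_succ_le h)
    obtain ⟨i, hi⟩ := this
    have hiR : i + 1 < R + 1 := by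
      by_contra! hle
      have := h0 (i + 1) (by omega)
      omega
    by_cases h1 : μ.rowLen i ≤ f i
    · refine Finset.prod_eq_zero (Finset.mem_range.2 hiR) (if_neg ?_)
      rw [consRow]
      omega
    · exact Finset.prod_eq_zero (i := i) (Finset.mem_range.2 (by omega)) (if_neg (by omega))

/-! ### Inversion of an even number of variables -/

open Classical in
/-- The skew `q`-Whittaker polynomial with the variables given as a list. -/
def whittakerList (q : ℂ) : List ℂ → YoungDiagram → YoungDiagram → ℂ
  | [], lam, μ => if lam = μ then 1 else 0
  | x :: l, lam, μ => ∑ ν ∈ subdiagrams lam, whittakerOne q x lam ν * whittakerList q l ν μ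

theorem whittaker_eq_whittakerList (q : ℂ) {N : ℕ} (x : Fin N → ℂ) :
    whittaker q N x = whittakerList q (List.ofFn x) := by
  induction N with
  | zero =>
    funext lam μ
    simp [whittaker, whittakerList]
  | succ N ih =>
    funext lam μ
    rw [List.ofFn_succ, whittaker, whittakerList, ih]
    rfl

theorem whittakerList_le {q : ℂ} {l : List ℂ} {lam μ : YoungDiagram}
    (h : whittakerList q l lam μ ≠ 0) : μ ≤ lam := by
  induction l generalizing lam with
  | nil =>
    rw [whittakerList] at h
    exact (of_not_not fun h' => h (if_neg h') : lam = μ).ge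
  | cons x l ih =>
    obtain ⟨ν, hν, h⟩ := Finset.exists_ne_zero_of_sum_ne_zero h
    exact (ih (right_ne_zero_of_mul h)).trans (mem_subdiagrams.1 hν)

theorem isHorizontalStrip_colLen {lam ν : YoungDiagram} (h : IsHorizontalStrip lam ν) :
    lam.colLen 0 ≤ ν.colLen 0 + 1 := by
  refine colLen_zero_le_of_rowLen_eq_zero ?_
  have := (h (ν.colLen 0)).2
  rw [rowLen_eq_zero le_rfl le_rfl] at this
  omega

theorem whittakerList_colLen {q : ℂ} {l : List ℂ} {lam μ : YoungDiagram}
    (h : whittakerList q l lam μ ≠ 0) : lam.colLen 0 ≤ μ.colLen 0 + l.length := by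
  induction l generalizing lam with
  | nil =>
    rw [whittakerList] at h
    rw [(of_not_not fun h' => h (if_neg h') : lam = μ)]
    simp
  | cons x l ih =>
    obtain ⟨ν, hν, h⟩ := Finset.exists_ne_zero_of_sum_ne_zero h
    have h1 := ih (right_ne_zero_of_mul h)
    have h2 := isHorizontalStrip_colLen
      (isHorizontalStrip_of_whittakerOne_ne_zero (left_ne_zero_of_mul h))
    rw [List.length_cons]
    omega

/-- The skew `q`-Whittaker polynomials are symmetric in their variables. -/
theorem whittakerList_perm {q : ℂ} (hq : ∀ k : ℕ, 0 < k → q ^ k ≠ 1) {l l' : List ℂ}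
    (h : l.Perm l') (lam μ : YoungDiagram) : whittakerList q l lam μ = whittakerList q l' lam μ := by
  induction h generalizing lam with
  | nil => rfl
  | cons x _ ih => simp only [whittakerList, ih]
  | trans _ _ ih1 ih2 => rw [ih1, ih2]
  | swap x y l =>
    have key : ∀ x y : ℂ, whittakerList q (x :: y :: l) lam μ =
        ∑ κ ∈ subdiagrams lam, (∑ ν ∈ subdiagrams lam,
          whittakerOne q x lam ν * whittakerOne q y ν κ) * whittakerList q l κ μ := by
      intro x y
      simp only [whittakerList, Finset.sum_mul]
      rw [Finset.sum_comm]
      refine Finset.sum_congr rfl fun ν hν => ?_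
      rw [Finset.mul_sum]
      refine (Finset.sum_subset (fun κ hκ => mem_subdiagrams.2
        ((mem_subdiagrams.1 hκ).trans (mem_subdiagrams.1 hν))) fun κ _ hκ => ?_).trans
        (Finset.sum_congr rfl fun κ _ => (mul_assoc _ _ _).symm)
      rw [whittakerOne_eq_zero fun h => hκ (mem_subdiagrams.2 h)]
      simp
    rw [key, key]
    refine Finset.sum_congr rfl fun κ _ => ?_
    rw [sum_whittakerOne_comm hq]

/-- The coefficient of the right boundary polynomial of `μ` in `Z_n`, summed over the partitions
`lam` in a box. For boxes with sufficiently many rows it does not depend on the box. -/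
def leftSum (n : ℕ) (q a b : ℂ) (R : ℕ) (l : List ℂ) (μ : YoungDiagram) : ℂ :=
  ∑ lam ∈ box n R, leftWeight n q a b lam * whittakerList q l lam μ

theorem leftSum_perm {q : ℂ} (hq : ∀ k : ℕ, 0 < k → q ^ k ≠ 1) (n : ℕ) (a b : ℂ) (R : ℕ)
    {l l' : List ℂ} (h : l.Perm l') (μ : YoungDiagram) :
    leftSum n q a b R l μ = leftSum n q a b R l' μ := by
  simp only [leftSum, whittakerList_perm hq h]

theorem leftSum_comm (n : ℕ) (q a b : ℂ) (R : ℕ) (l : List ℂ) (μ : YoungDiagram) :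
    leftSum n q a b R l μ = leftSum n q b a R l μ := by
  simp only [leftSum, leftWeight_comm n q a b]

theorem leftSum_inv (n : ℕ) (q : ℂ) {a b : ℂ} (ha : a ≠ 0) (hb : b ≠ 0) (R : ℕ) (l : List ℂ)
    (μ : YoungDiagram) :
    leftSum n q a⁻¹ b⁻¹ R l μ = (a * b)⁻¹ ^ n * leftSum n q a b R l μ := by
  rw [leftSum, leftSum, Finset.mul_sum]
  refine Finset.sum_congr rfl fun lam hlam => ?_
  rw [leftWeight_inv q ha hb (mem_box.1 hlam).1, mul_assoc]

theorem leftSum_eq_cons {q : ℂ} (hq : ∀ k : ℕ, 0 < k → q ^ k ≠ 1) (n : ℕ) (a b : ℂ) {R : ℕ}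
    {l : List ℂ} {μ : YoungDiagram} (hR : μ.colLen 0 + l.length + 1 ≤ R) :
    leftSum n q a b R l μ = leftSum n q a 0 R (b :: l) μ := by
  obtain ⟨R, rfl⟩ : ∃ R', R = R' + 1 := ⟨R - 1, by omega⟩
  have h1 : leftSum n q a 0 (R + 1) (b :: l) μ = ∑ ν ∈ box n (R + 1),
      (∑ lam ∈ box n (R + 1), leftWeight n q a 0 lam * whittakerOne q b lam ν) *
        whittakerList q l ν μ := by
    simp only [leftSum, whittakerList, Finset.sum_mul]
    rw [Finset.sum_comm]
    refine Finset.sum_congr rfl fun lam hlam => ?_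
    rw [sum_subdiagrams_eq_sum_box hlam, Finset.mul_sum]
    · exact Finset.sum_congr rfl fun ν _ => (mul_assoc _ _ _).symm
    · intro ν hν
      rw [whittakerOne_eq_zero hν, zero_mul]
  rw [h1, leftSum]
  refine Finset.sum_congr rfl fun ν hν => ?_
  by_cases h : whittakerList q l ν μ = 0
  · simp [h]
  · have := whittakerList_colLen h
    rw [sum_leftWeight_mul_whittakerOne hq a b
      (mem_box.2 ⟨(mem_box.1 hν).1, by omega⟩ : ν ∈ box n R)]

/-- Both parameters of the left boundary play the same role as the variables. -/
theorem leftSum_eq_cons_cons {q : ℂ} (hq : ∀ k : ℕ, 0 < k → q ^ k ≠ 1) (n : ℕ) (a b : ℂ) {R : ℕ}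
    {l : List ℂ} {μ : YoungDiagram} (hR : μ.colLen 0 + l.length + 2 ≤ R) :
    leftSum n q a b R l μ = leftSum n q 0 0 R (a :: b :: l) μ := by
  rw [leftSum_eq_cons hq n a b (by omega), leftSum_comm, leftSum_eq_cons hq n 0 a]
  rw [List.length_cons]
  omega

theorem leftSum_invertOn_pair {q : ℂ} (hq : ∀ k : ℕ, 0 < k → q ^ k ≠ 1) (n : ℕ) {R M : ℕ}
    {μ : YoungDiagram} (hR : μ.colLen 0 + M ≤ R) (y : Fin M → ℂ) {i j : Fin M} (hij : i ≠ j)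
    (hi : y i ≠ 0) (hj : y j ≠ 0) :
    leftSum n q 0 0 R (List.ofFn (invertOn {i, j} y)) μ =
      (y i * y j)⁻¹ ^ n * leftSum n q 0 0 R (List.ofFn y) μ := by
  set rest := ((List.finRange M).erase i).erase j with hrest
  have hmem : j ∈ (List.finRange M).erase i :=
    (List.mem_erase_of_ne hij.symm).2 (List.mem_finRange j)
  have hperm : (List.finRange M).Perm (i :: j :: rest) :=
    (List.perm_cons_erase (List.mem_finRange i)).trans ((List.perm_cons_erase hmem).cons i)
  have hlen : rest.length + 2 = M := by
    have := hperm.length_eq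
    simpa using this.symm
  have hnodup : (i :: j :: rest).Nodup := hperm.nodup_iff.1 (List.nodup_finRange M)
  have key : ∀ z : Fin M → ℂ, leftSum n q 0 0 R (List.ofFn z) μ =
      leftSum n q (z i) (z j) R (rest.map z) μ := by
    intro z
    rw [List.ofFn_eq_map, leftSum_perm hq n 0 0 R (hperm.map z), List.map_cons, List.map_cons,
      ← leftSum_eq_cons_cons hq]
    rw [List.length_map]
    omega
  have hmap : rest.map (invertOn {i, j} y) = rest.map y := by
    refine List.map_congr_left fun k hk => ?_
    rw [List.nodup_cons, List.nodup_cons] at hnodup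
    have h1 : k ≠ i := by
      rintro rfl
      exact hnodup.1 (List.mem_cons_of_mem _ hk)
    have h2 : k ≠ j := by
      rintro rfl
      exact hnodup.2.1 hk
    simp [invertOn, h1, h2]
  rw [key, key, hmap]
  have e1 : invertOn {i, j} y i = (y i)⁻¹ := by simp [invertOn]
  have e2 : invertOn {i, j} y j = (y j)⁻¹ := by simp [invertOn]
  rw [e1, e2, leftSum_inv n q hi hj]

theorem leftSum_invertOn {q : ℂ} (hq : ∀ k : ℕ, 0 < k → q ^ k ≠ 1) (n : ℕ) {R M : ℕ}
    {μ : YoungDiagram} (hR : μ.colLen 0 + M ≤ R) (y : Fin M → ℂ) (S : Finset (Fin M))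
    (hS : Even S.card) (hy : ∀ i ∈ S, y i ≠ 0) :
    leftSum n q 0 0 R (List.ofFn (invertOn S y)) μ =
      (∏ i ∈ S, y i)⁻¹ ^ n * leftSum n q 0 0 R (List.ofFn y) μ := by
  induction hk : S.card using Nat.strong_induction_on generalizing S with
  | _ k ih =>
    subst hk
    rcases S.eq_empty_or_nonempty with rfl | ⟨i, hi⟩
    · have : invertOn ∅ y = y := by
        funext i
        simp [invertOn]
      simp [this]
    have hc1 := Finset.card_erase_add_one hi
    have hne : (S.erase i).Nonempty := by
      rw [← Finset.card_pos]
      obtain ⟨m, hm⟩ := hS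
      omega
    obtain ⟨j, hj⟩ := hne
    have hc2 := Finset.card_erase_add_one hj
    have hji : j ≠ i := Finset.ne_of_mem_erase hj
    have hjS : j ∈ S := Finset.mem_of_mem_erase hj
    set T := (S.erase i).erase j with hT
    have hiT : i ∉ T := by simp [hT]
    have hjT : j ∉ T := by simp [hT]
    have h1 : invertOn S y = invertOn {i, j} (invertOn T y) := by
      funext k
      by_cases h1 : k = i
      · subst h1
        simp [invertOn, hi, hiT]
      · by_cases h2 : k = j
        · subst h2
          simp [invertOn, hjS, hjT]
        · simp [invertOn, h1, h2, hT]
    have h2 : invertOn T y i = y i := if_neg hiT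
    have h3 : invertOn T y j = y j := if_neg hjT
    rw [h1, leftSum_invertOn_pair hq n hR _ hji.symm (by rw [h2]; exact hy i hi)
      (by rw [h3]; exact hy j hjS), h2, h3,
      ih T.card (by omega) T (by obtain ⟨m, hm⟩ := hS; exact ⟨m - 1, by omega⟩)
        (fun k hk => hy k (Finset.mem_of_mem_erase (Finset.mem_of_mem_erase hk))) rfl,
      ← Finset.mul_prod_erase S y hi, ← Finset.mul_prod_erase (S.erase i) y hj, ← mul_assoc,
      ← mul_pow, ← mul_inv, ← mul_assoc]

/-! ### Absolute convergence -/

theorem colLen_eq_zero {ν : YoungDiagram} {n j : ℕ} (hn : ν.rowLen 0 ≤ n) (hj : n ≤ j) :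
    ν.colLen j = 0 := by
  have := rowLen_eq_zero (ν := ν.transpose) (R := n) (i := j) (by simpa using hn) hj
  simpa using this

theorem card_eq_sum_colLen_fin {ν : YoungDiagram} {n : ℕ} (hn : ν.rowLen 0 ≤ n) :
    ν.card = ∑ j : Fin n, ν.colLen j := by
  rw [← transpose_card, card_eq_sum_rowLen (R := n) (by simpa using hn), Finset.sum_range]
  simp

theorem summable_pow_sum (n : ℕ) {s : ℝ} (h0 : 0 ≤ s) (h1 : s < 1) :
    Summable fun f : Fin n → ℕ => s ^ ∑ j, f j := by
  induction n with
  | zero => exact Summable.of_finite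
  | succ n ih =>
    rw [← (Fin.consEquiv fun _ => ℕ).summable_iff]
    refine ((summable_geometric_of_lt_one h0 h1).mul_of_nonneg ih (fun _ => by positivity)
      (fun _ => by positivity)).congr ?_
    rintro ⟨v, f⟩
    simp [Fin.consEquiv, Fin.sum_univ_succ, pow_add]

/-- Partitions with parts at most `n` are determined by their first `n` columns, so their generating
function is dominated by a product of geometric series. -/
theorem summable_pow_card (n : ℕ) {s : ℝ} (h0 : 0 ≤ s) (h1 : s < 1) :
    Summable fun ν : {ν : YoungDiagram // ν.rowLen 0 ≤ n} => s ^ ν.1.card := by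
  have hinj : Function.Injective
      (fun (ν : {ν : YoungDiagram // ν.rowLen 0 ≤ n}) (j : Fin n) => ν.1.colLen j) := by
    rintro ⟨ν, hν⟩ ⟨κ, hκ⟩ h
    rw [Subtype.mk.injEq, ← YoungDiagram.transpose_eq_iff]
    refine eq_of_rowLen_eq fun j => ?_
    rw [YoungDiagram.rowLen_transpose, YoungDiagram.rowLen_transpose]
    by_cases hj : j < n
    · exact congrFun h ⟨j, hj⟩
    · rw [colLen_eq_zero hν (by omega), colLen_eq_zero hκ (by omega)]
  refine ((summable_pow_sum n h0 h1).comp_injective hinj).congr ?_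
  rintro ⟨ν, hν⟩
  rw [Function.comp_apply, card_eq_sum_colLen_fin hν]

theorem exists_norm_le_pow {ι : Type*} (S : Finset ι) (n : ℕ) (g : ι → ℕ → ℂ)
    (h0 : ∀ i ∈ S, ‖g i 0‖ ≤ 1) :
    ∃ D : ℝ, 1 ≤ D ∧ ∀ i ∈ S, ∀ m ≤ n, ‖g i m‖ ≤ D ^ m := by
  have hnn : ∀ i, 0 ≤ ∑ m ∈ Finset.range (n + 1), ‖g i m‖ :=
    fun i => Finset.sum_nonneg fun _ _ => norm_nonneg _
  have hD : 1 ≤ 1 + ∑ i ∈ S, ∑ m ∈ Finset.range (n + 1), ‖g i m‖ :=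
    le_add_of_nonneg_right (Finset.sum_nonneg fun i _ => hnn i)
  refine ⟨_, hD, fun i hi m hm => ?_⟩
  cases m with
  | zero => simpa using h0 i hi
  | succ m =>
    refine le_trans ?_ (le_self_pow₀ hD m.succ_ne_zero)
    have h1 : ‖g i (m + 1)‖ ≤ ∑ m ∈ Finset.range (n + 1), ‖g i m‖ :=
      Finset.single_le_sum (f := fun m => ‖g i m‖) (fun _ _ => norm_nonneg _)
        (Finset.mem_range.2 (by omega))
    have h2 := Finset.single_le_sum (f := fun i => ∑ m ∈ Finset.range (n + 1), ‖g i m‖)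
      (fun i _ => hnn i) hi
    exact (h1.trans h2).trans (le_add_of_nonneg_left zero_le_one)

/-- A bound for a family that only depends on the parity of its index. -/
theorem exists_norm_ite_even_le_pow (n : ℕ) (g g' : ℕ → ℂ) (h : g 0 = 1) (h' : g' 0 = 1) :
    ∃ D : ℝ, 1 ≤ D ∧ ∀ i : ℕ, ∀ m ≤ n, ‖if Even i then g m else g' m‖ ≤ D ^ m := by
  obtain ⟨D, hD, hb⟩ := exists_norm_le_pow Finset.univ n
    (fun i : Bool => if i then g else g') (by simp [h, h'])
  refine ⟨D, hD, fun i m hm => ?_⟩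
  split_ifs
  · simpa using hb true (Finset.mem_univ _) m hm
  · simpa using hb false (Finset.mem_univ _) m hm

theorem exists_norm_leftWeight_le (n : ℕ) (q a b : ℂ) :
    ∃ C : ℝ, 0 ≤ C ∧ ∀ lam : YoungDiagram, lam.rowLen 0 ≤ n → ‖leftWeight n q a b lam‖ ≤ C := by
  obtain ⟨D, hD, hb⟩ := exists_norm_ite_even_le_pow n
    (fun m => rogersSzegoHom q m 1 (a * b) / qPoch q m) (fun m => rogersSzegoHom q m a b / qPoch q m)
    (by simp [rogersSzegoHom_zero_left, qPoch_zero])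
    (by simp [rogersSzegoHom_zero_left, qPoch_zero])
  refine ⟨D ^ n, by positivity, fun lam hn => ?_⟩
  have hsum := sum_consRow_sub hn (lam.colLen 0)
  rw [rowLen_eq_zero le_rfl le_rfl, Nat.sub_zero] at hsum
  rw [leftWeight_eq_prod n q a b le_rfl, norm_prod]
  nth_rewrite 3 [← hsum]
  rw [← Finset.prod_pow_eq_pow_sum]
  refine Finset.prod_le_prod (fun _ _ => norm_nonneg _) fun i hi => ?_
  have hle := Finset.single_le_sum
    (f := fun i => consRow n lam.rowLen i - consRow n lam.rowLen (i + 1))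
    (fun _ _ => Nat.zero_le _) hi
  rw [hsum] at hle
  have := hb i _ hle
  rwa [← ite_div] at this

theorem sum_rowLen_sub {lam : YoungDiagram} (R : ℕ) :
    ∑ i ∈ Finset.range R, (lam.rowLen i - lam.rowLen (i + 1)) = lam.rowLen 0 - lam.rowLen R := by
  have := sum_consRow_sub (lam := lam) le_rfl R
  rw [Finset.sum_range_succ'] at this
  simpa [consRow] using this

theorem exists_norm_whittakerOne_le (n : ℕ) (q x : ℂ) :
    ∃ C : ℝ, 0 ≤ C ∧ ∀ lam ν : YoungDiagram, lam.rowLen 0 ≤ n → ‖whittakerOne q x lam ν‖ ≤ C := by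
  obtain ⟨D, hD, hb⟩ := exists_norm_le_pow (Finset.range (n + 1)) n
    (fun k m => x ^ k * gaussBinom q m k) (by
      intro k _
      cases k with
      | zero => simp [gaussBinom_of_le, qPoch_zero]
      | succ k => simp [gaussBinom_of_lt])
  refine ⟨D ^ n, by positivity, fun lam ν hn => ?_⟩
  by_cases hs : ν ≤ lam
  swap
  · rw [whittakerOne_eq_zero hs, norm_zero]
    positivity
  rw [whittakerOne_eq_prod q x le_rfl (colLen_mono hs 0), norm_prod]
  refine le_trans ?_ (pow_le_pow_right₀ hD
    ((sum_rowLen_sub (lam := lam) (lam.colLen 0)).le.trans ((Nat.sub_le _ _).trans hn)))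
  rw [← Finset.prod_pow_eq_pow_sum]
  refine Finset.prod_le_prod (fun _ _ => norm_nonneg _) fun i _ => ?_
  have h0 := lam.rowLen_anti 0 i i.zero_le
  rw [rowWeight]
  split_ifs with h
  · exact hb _ (Finset.mem_range.2 (by omega)) _ (by omega)
  · rw [norm_zero]
    positivity

/-- For a fixed number of variables, the skew `q`-Whittaker polynomials grow more slowly in the
size of `lam` than any exponential. -/
theorem exists_norm_whittakerList_le (n : ℕ) (q : ℂ) (l : List ℂ) {s : ℝ} (h0 : 0 < s)
    (h1 : s < 1) :
    ∃ C : ℝ, 0 ≤ C ∧ ∀ lam μ : YoungDiagram, lam.rowLen 0 ≤ n →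
      ‖whittakerList q l lam μ‖ ≤ C * s⁻¹ ^ lam.card := by
  induction l generalizing s with
  | nil =>
    refine ⟨1, zero_le_one, fun lam μ _ => ?_⟩
    have : 1 ≤ s⁻¹ ^ lam.card := one_le_pow₀ (one_le_inv_iff₀.2 ⟨h0, h1.le⟩)
    rw [whittakerList, one_mul]
    refine le_trans ?_ this
    split_ifs <;> simp
  | cons x l ih =>
    -- The sum over `ν` costs a factor: half of the allowed growth makes it a convergent series.
    set r := √s with hr
    have hr0 : 0 < r := Real.sqrt_pos.2 h0
    have hr1 : r < 1 := by
      rw [hr, Real.sqrt_lt' one_pos]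
      simpa using h1
    have hrs : s = r ^ 2 := (Real.sq_sqrt h0.le).symm
    obtain ⟨C, hC, hb⟩ := ih hr0 hr1
    obtain ⟨D, hD, hb'⟩ := exists_norm_whittakerOne_le n q x
    have hsum := summable_pow_card n hr0.le hr1
    set K := ∑' ν : {ν : YoungDiagram // ν.rowLen 0 ≤ n}, r ^ ν.1.card
    refine ⟨D * C * K, mul_nonneg (mul_nonneg hD hC) (tsum_nonneg fun _ => by positivity),
      fun lam μ hn => ?_⟩
    have hterm : ∀ ν ∈ subdiagrams lam, ‖whittakerOne q x lam ν * whittakerList q l ν μ‖ ≤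
        D * C * s⁻¹ ^ lam.card * r ^ ν.card := by
      intro ν hν
      have hle := mem_subdiagrams.1 hν
      rw [norm_mul]
      have e1 : r⁻¹ ^ ν.card ≤ s⁻¹ ^ lam.card * r ^ ν.card := by
        have e2 : r⁻¹ ^ ν.card = s⁻¹ ^ ν.card * r ^ ν.card := by
          rw [← mul_pow, hrs]
          congr 1
          field_simp
        rw [e2]
        refine mul_le_mul_of_nonneg_right ?_ (by positivity)
        exact pow_le_pow_right₀ (one_le_inv_iff₀.2 ⟨h0, h1.le⟩)
          (Finset.card_le_card (YoungDiagram.cells_subset_iff.2 hle))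
      calc ‖whittakerOne q x lam ν‖ * ‖whittakerList q l ν μ‖
          ≤ D * (C * r⁻¹ ^ ν.card) :=
            mul_le_mul (hb' lam ν hn) (hb ν μ ((rowLen_mono hle 0).trans hn)) (norm_nonneg _) hD
        _ ≤ D * (C * (s⁻¹ ^ lam.card * r ^ ν.card)) := by gcongr
        _ = _ := by ring
    have hK : ∑ ν ∈ subdiagrams lam, r ^ ν.card ≤ K := by
      have := hsum.sum_le_tsum ((subdiagrams lam).subtype fun ν => ν.rowLen 0 ≤ n)
        (fun _ _ => by positivity)
      rwa [Finset.sum_subtype_of_mem (fun ν : YoungDiagram => r ^ ν.card)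
        (fun ν hν => (rowLen_mono (mem_subdiagrams.1 hν) 0).trans hn)] at this
    rw [whittakerList]
    refine (norm_sum_le_of_le _ hterm).trans ?_
    rw [← Finset.mul_sum]
    calc D * C * s⁻¹ ^ lam.card * ∑ ν ∈ subdiagrams lam, r ^ ν.card
        ≤ D * C * s⁻¹ ^ lam.card * K := by gcongr
      _ = _ := by ring

theorem card_le_of_whittakerList_ne_zero {q : ℂ} {l : List ℂ} {lam μ : YoungDiagram} {n : ℕ}
    (hn : lam.rowLen 0 ≤ n) (h : whittakerList q l lam μ ≠ 0) :
    lam.card ≤ μ.card + n * l.length := by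
  induction l generalizing lam with
  | nil =>
    rw [whittakerList] at h
    rw [(of_not_not fun h' => h (if_neg h') : lam = μ)]
    simp
  | cons x l ih =>
    obtain ⟨ν, hν, h⟩ := Finset.exists_ne_zero_of_sum_ne_zero h
    have h1 := ih ((rowLen_mono (mem_subdiagrams.1 hν) 0).trans hn) (right_ne_zero_of_mul h)
    have h2 := isHorizontalStrip_of_whittakerOne_ne_zero (left_ne_zero_of_mul h)
    have h3 := card_sub_card h2 le_rfl
    have h4 : ∑ i ∈ Finset.range (lam.colLen 0), (lam.rowLen i - ν.rowLen i) ≤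
        ∑ i ∈ Finset.range (lam.colLen 0), (lam.rowLen i - lam.rowLen (i + 1)) :=
      Finset.sum_le_sum fun i _ => Nat.sub_le_sub_left (h2 i).2 _
    rw [sum_rowLen_sub] at h4
    rw [List.length_cons, mul_add, mul_one]
    omega

theorem sum_mult_eq (ν : YoungDiagram) (k : ℕ) :
    ∑ i ∈ Finset.range k, mult ν i = ν.colLen 0 - ν.colLen k := by
  have := sum_rowLen_sub (lam := ν.transpose) k
  simpa [mult] using this

/-- The right boundary weight decays exponentially. A part of size `i + 1` contributes only `i / 2`
powers of `t`, but the number of parts of `ν` is bounded. -/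
theorem exists_norm_hScaled_le (n : ℕ) (q c d : ℂ) {t : ℂ} {s : ℝ} (h0 : 0 < s) (h1 : s < 1)
    (ht : ‖t‖ ≤ s ^ 2) :
    ∃ C : ℝ, 0 ≤ C ∧ ∀ ν : YoungDiagram, ν.colLen 0 ≤ n →
      ‖hScaled q t c d ν‖ ≤ C * s ^ ν.card := by
  obtain ⟨D, hD, hb⟩ := exists_norm_ite_even_le_pow n
    (fun m => rogersSzegoHom q m c d) (fun m => rogersSzegoHom q m t (c * d))
    (rogersSzegoHom_zero_left _ _ _) (rogersSzegoHom_zero_left _ _ _)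
  have hE : 1 ≤ D * (s ^ 2)⁻¹ :=
    one_le_mul_of_one_le_of_one_le hD
      (one_le_inv_iff₀.2 ⟨by positivity, pow_le_one₀ h0.le h1.le⟩)
  refine ⟨(D * (s ^ 2)⁻¹) ^ n, by positivity, fun ν hn => ?_⟩
  have hm : ∀ i, mult ν i ≤ n := fun i =>
    (Nat.sub_le _ _).trans ((ν.colLen_anti 0 i i.zero_le).trans hn)
  have hsum : ∑ i ∈ Finset.range (ν.rowLen 0), mult ν i ≤ n :=
    (sum_mult_eq ν _).le.trans ((Nat.sub_le _ _).trans hn)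
  refine le_trans ?_ (mul_le_mul_of_nonneg_right (pow_le_pow_right₀ hE hsum) (by positivity))
  rw [card_eq_sum_mult, ← Finset.prod_pow_eq_pow_sum, ← Finset.prod_pow_eq_pow_sum,
    ← Finset.prod_mul_distrib, hScaled, norm_prod]
  refine Finset.prod_le_prod (fun _ _ => norm_nonneg _) fun i _ => ?_
  rw [norm_mul, norm_pow]
  have e1 : ‖t‖ ^ (i / 2 * mult ν i) ≤ (s ^ 2)⁻¹ ^ mult ν i * s ^ ((i + 1) * mult ν i) := by
    rw [pow_mul, pow_mul s (i + 1), ← mul_pow]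
    refine pow_le_pow_left₀ (by positivity) ?_ _
    have e2 : s ^ (2 * (i / 2) + 2) ≤ s ^ (i + 1) := pow_le_pow_of_le_one h0.le h1.le (by omega)
    calc ‖t‖ ^ (i / 2) ≤ (s ^ 2) ^ (i / 2) := pow_le_pow_left₀ (norm_nonneg _) ht _
      _ = (s ^ 2)⁻¹ * s ^ (2 * (i / 2) + 2) := by
        rw [pow_add, pow_mul]
        field_simp
      _ ≤ _ := by gcongr
  calc _ ≤ ((s ^ 2)⁻¹ ^ mult ν i * s ^ ((i + 1) * mult ν i)) * D ^ mult ν i :=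
        mul_le_mul e1 (hb i _ (hm i)) (norm_nonneg _) (by positivity)
    _ = _ := by rw [mul_pow]; ring

theorem zTerm_eq (n : ℕ) {N : ℕ} (x : Fin N → ℂ) (q t a b c d : ℂ) (p : Pairs n) :
    zTerm n x q t a b c d p = leftWeight n q a b p.1.1 *
      whittakerList q (List.ofFn x) p.1.1 p.1.2 * hScaled q t c d p.1.2.transpose := by
  rw [← whittaker_eq_whittakerList]
  rfl

theorem summable_zTerm (n : ℕ) {N : ℕ} (x : Fin N → ℂ) (q : ℂ) {t : ℂ} (ht : ‖t‖ < 1)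
    (a b c d : ℂ) : Summable (zTerm n x q t a b c d) := by
  -- The right weight is then `O(s^{3|μ|})`. One factor `s^{|μ|}` makes the sum over `μ` converge,
  -- and `s^{2|μ|} = O(s^{2|lam|})` beats the growth `s^{-|lam|}` of the Whittaker polynomial.
  obtain ⟨s, hs0, hs1, hts⟩ : ∃ s : ℝ, 0 < s ∧ s < 1 ∧ ‖t‖ ≤ (s ^ 3) ^ 2 := by
    have hm0 : 0 < max ‖t‖ (1 / 2) := lt_max_of_lt_right (by norm_num)
    have hm1 : max ‖t‖ (1 / 2) < 1 := max_lt ht (by norm_num)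
    refine ⟨max ‖t‖ (1 / 2) ^ ((6 : ℕ) : ℝ)⁻¹, Real.rpow_pos_of_pos hm0 _,
      Real.rpow_lt_one hm0.le hm1 (by positivity), ?_⟩
    rw [← pow_mul, Real.rpow_inv_natCast_pow hm0.le (by norm_num)]
    exact le_max_left _ _
  obtain ⟨C1, hC1, hb1⟩ := exists_norm_leftWeight_le n q a b
  obtain ⟨C2, hC2, hb2⟩ := exists_norm_whittakerList_le n q (List.ofFn x) hs0 hs1
  obtain ⟨C3, hC3, hb3⟩ := exists_norm_hScaled_le n q c d (pow_pos hs0 3)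
    (pow_lt_one₀ hs0.le hs1 (by norm_num)) hts
  have hsum := summable_pow_card n hs0.le hs1
  have hinj : Function.Injective (fun p : Pairs n =>
      ((⟨p.1.1, p.2.2⟩, ⟨p.1.2, (rowLen_mono p.2.1 0).trans p.2.2⟩) :
        {ν : YoungDiagram // ν.rowLen 0 ≤ n} × {ν : YoungDiagram // ν.rowLen 0 ≤ n})) := by
    rintro ⟨⟨l1, m1⟩, h1⟩ ⟨⟨l2, m2⟩, h2⟩ h
    simp only [Prod.mk.injEq, Subtype.mk.injEq] at h
    obtain ⟨rfl, rfl⟩ := h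
    rfl
  have hprod := ((hsum.mul_of_nonneg hsum (fun _ => by positivity)
    (fun _ => by positivity)).comp_injective hinj).mul_left
      (C1 * C2 * C3 * (s⁻¹ ^ (2 * (n * N))))
  refine Summable.of_norm_bounded hprod ?_
  intro p
  rw [zTerm_eq]
  simp only [Function.comp_apply]
  obtain ⟨hle, hn⟩ := p.2
  generalize p.1.1 = lam at *
  generalize p.1.2 = μ at *
  by_cases hw : whittakerList q (List.ofFn x) lam μ = 0
  · rw [hw, mul_zero, zero_mul, norm_zero]
    positivity
  have hcard := card_le_of_whittakerList_ne_zero hn hw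
  rw [List.length_ofFn] at hcard
  have e3 := hb3 μ.transpose (by simpa using (rowLen_mono hle 0).trans hn)
  rw [transpose_card] at e3
  rw [norm_mul, norm_mul]
  have e4 : s⁻¹ ^ lam.card * (s ^ 3) ^ μ.card ≤
      s⁻¹ ^ (2 * (n * N)) * (s ^ lam.card * s ^ μ.card) := by
    have e5 : s ^ (2 * (μ.card + n * N)) ≤ s ^ (2 * lam.card) :=
      pow_le_pow_of_le_one hs0.le hs1.le (by omega)
    calc s⁻¹ ^ lam.card * (s ^ 3) ^ μ.card
        = s⁻¹ ^ lam.card * s⁻¹ ^ (2 * (n * N)) * s ^ μ.card * s ^ (2 * (μ.card + n * N)) := by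
          rw [mul_add, pow_add, ← pow_mul, show 3 * μ.card = μ.card + 2 * μ.card by ring, pow_add,
            inv_pow, inv_pow]
          field_simp
      _ ≤ s⁻¹ ^ lam.card * s⁻¹ ^ (2 * (n * N)) * s ^ μ.card * s ^ (2 * lam.card) := by gcongr
      _ = _ := by
          rw [two_mul lam.card, pow_add, inv_pow, inv_pow]
          field_simp
  calc _ ≤ C1 * (C2 * s⁻¹ ^ lam.card) * (C3 * (s ^ 3) ^ μ.card) := by
        refine mul_le_mul (mul_le_mul (hb1 lam hn) (hb2 lam μ hn) (norm_nonneg _) hC1) e3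
          (norm_nonneg _) (by positivity)
    _ = C1 * C2 * C3 * (s⁻¹ ^ lam.card * (s ^ 3) ^ μ.card) := by ring
    _ ≤ C1 * C2 * C3 * (s⁻¹ ^ (2 * (n * N)) * (s ^ lam.card * s ^ μ.card)) := by gcongr
    _ = _ := by ring

theorem tsum_prod_swap {α β : Type*} {F : α × β → ℂ} (hF : Summable F) :
    ∑' p, F p = ∑' b, ∑' a, F (a, b) := by
  rw [← (Equiv.prodComm β α).tsum_eq F]
  exact Summable.tsum_prod (f := fun p : β × α => F p.swap)
    ((Equiv.prodComm β α).summable_iff.2 hF)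

/-- The sum over `lam` in `Z_n` is finite for each `μ`. -/
theorem Z_eq_tsum_leftSum (n : ℕ) {N : ℕ} (x : Fin N → ℂ) (q : ℂ) {t : ℂ} (ht : ‖t‖ < 1)
    (a b c d : ℂ) :
    Z n x q t a b c d = ∑' μ : YoungDiagram,
      leftSum n q a b (μ.colLen 0 + (N + 2)) (List.ofFn x) μ * hScaled q t c d μ.transpose := by
  set F : YoungDiagram × YoungDiagram → ℂ := fun p => if p.1.rowLen 0 ≤ n then
    leftWeight n q a b p.1 * whittakerList q (List.ofFn x) p.1 p.2 *
      hScaled q t c d p.2.transpose else 0 with hF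
  set incl : Pairs n → YoungDiagram × YoungDiagram := Subtype.val with hincl
  have hinj : Function.Injective incl := Subtype.val_injective
  have hsupp : Function.support F ⊆ Set.range incl := by
    intro p hp
    have hn : p.1.rowLen 0 ≤ n := by
      by_contra h
      exact hp (if_neg h)
    have hp' : F p = _ := if_pos hn
    rw [Function.mem_support, hp'] at hp
    exact ⟨⟨p, whittakerList_le (right_ne_zero_of_mul (left_ne_zero_of_mul hp)), hn⟩, rfl⟩
  have hFz : zTerm n x q t a b c d = F ∘ incl := by
    funext p
    rw [zTerm_eq, hF]
    exact (if_pos p.2.2).symm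
  have hsum : Summable F := by
    have h := summable_zTerm n x q ht a b c d
    rw [hFz] at h
    refine (hinj.summable_iff fun p hp => ?_).1 h
    by_contra hne
    exact hp (hsupp hne)
  have h1 : Z n x q t a b c d = ∑' p, F p := by
    rw [Z, hFz]
    exact hinj.tsum_eq hsupp
  rw [h1, tsum_prod_swap hsum]
  refine tsum_congr fun μ => ?_
  rw [tsum_eq_sum (s := box n (μ.colLen 0 + (N + 2))), leftSum, Finset.sum_mul]
  · refine Finset.sum_congr rfl fun lam hlam => ?_
    rw [hF]
    exact if_pos (mem_box.1 hlam).1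
  · intro lam hlam
    by_contra hne
    have hn : lam.rowLen 0 ≤ n := by
      by_contra h
      exact hne (if_neg h)
    have hp' : F (lam, μ) = _ := if_pos hn
    change F (lam, μ) ≠ 0 at hne
    rw [hp'] at hne
    have := whittakerList_colLen (right_ne_zero_of_mul (left_ne_zero_of_mul hne))
    rw [List.length_ofFn] at this
    dsimp only at this
    exact hlam (mem_box.2 ⟨hn, by omega⟩)

/-! ### Inversion formulas for `Z_n` -/

/-- Invariance of `Z_n` under the inversion of an even number of the variables
`a, b, x_1, …, x_N`, up to an elementary factor. -/
theorem Z_of_invertOn {q : ℂ} (hq : ∀ k : ℕ, 0 < k → q ^ k ≠ 1) (n : ℕ) {N : ℕ} {t : ℂ}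
    (ht : ‖t‖ < 1) {x x' : Fin N → ℂ} {a a' b b' : ℂ} (c d : ℂ) {y : Fin (N + 2) → ℂ}
    (hy : y = Fin.cons a (Fin.cons b x : Fin (N + 1) → ℂ)) (T : Finset (Fin (N + 2)))
    (hT : Even T.card) (hyT : ∀ i ∈ T, y i ≠ 0)
    (h : invertOn T y = Fin.cons a' (Fin.cons b' x' : Fin (N + 1) → ℂ)) :
    Z n x' q t a' b' c d = (∏ i ∈ T, y i)⁻¹ ^ n * Z n x q t a b c d := by
  rw [Z_eq_tsum_leftSum n x' q ht, Z_eq_tsum_leftSum n x q ht, ← tsum_mul_left]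
  refine tsum_congr fun μ => ?_
  have key : ∀ (a b : ℂ) (x : Fin N → ℂ),
      leftSum n q a b (μ.colLen 0 + (N + 2)) (List.ofFn x) μ =
        leftSum n q 0 0 (μ.colLen 0 + (N + 2))
          (List.ofFn (Fin.cons a (Fin.cons b x : Fin (N + 1) → ℂ) : Fin (N + 2) → ℂ)) μ := by
    intro a b x
    rw [List.ofFn_cons, List.ofFn_cons, leftSum_eq_cons_cons hq]
    rw [List.length_ofFn]
    omega
  rw [key, key, ← h, ← hy, leftSum_invertOn hq n le_rfl y T hT hyT, mul_assoc]

/-- The embedding of the indices of `x` into those of the tuple `a, b, x_1, …, x_N`. -/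
def shiftTwo (N : ℕ) : Fin N ↪ Fin (N + 2) :=
  (Fin.succEmb N).trans (Fin.succEmb (N + 1))

theorem shiftTwo_apply {N : ℕ} (i : Fin N) : shiftTwo N i = i.succ.succ := rfl

theorem Z_invertOn {q : ℂ} (hq : ∀ k : ℕ, 0 < k → q ^ k ≠ 1) (n : ℕ) {N : ℕ} {t : ℂ}
    (ht : ‖t‖ < 1) {x : Fin N → ℂ} (hx : ∀ i, x i ≠ 0) (a b c d : ℂ) {S : Finset (Fin N)}
    (hS : Even S.card) :
    Z n (invertOn S x) q t a b c d = (∏ i ∈ S, x i)⁻¹ ^ n * Z n x q t a b c d := by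
  rw [Z_of_invertOn hq n ht c d rfl (S.map (shiftTwo N)) (by simpa using hS)
    (x := x) (a := a) (b := b) (x' := invertOn S x) (a' := a) (b' := b)]
  · simp [shiftTwo_apply]
  · simp [shiftTwo_apply, hx]
  · funext i
    refine Fin.cases ?_ (fun i => Fin.cases ?_ (fun i => ?_) i) i
    · simp [invertOn, shiftTwo_apply, Fin.succ_ne_zero]
    · simp [invertOn, shiftTwo_apply, Fin.succ_succ_ne_one]
    · simp [invertOn, shiftTwo_apply]

theorem Z_inv_invertOn {q : ℂ} (hq : ∀ k : ℕ, 0 < k → q ^ k ≠ 1) (n : ℕ) {N : ℕ} {t : ℂ}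
    (ht : ‖t‖ < 1) {x : Fin N → ℂ} (hx : ∀ i, x i ≠ 0) {a : ℂ} (ha : a ≠ 0) (b c d : ℂ)
    {S : Finset (Fin N)} (hS : Odd S.card) :
    Z n (invertOn S x) q t a⁻¹ b c d = (a * ∏ i ∈ S, x i)⁻¹ ^ n * Z n x q t a b c d := by
  -- Index `0` is that of the variable `a`.
  have h0 : (0 : Fin (N + 2)) ∉ S.map (shiftTwo N) := by
    simp [shiftTwo_apply, Fin.succ_ne_zero]
  rw [Z_of_invertOn hq n ht c d rfl (insert 0 (S.map (shiftTwo N)))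
    (x := x) (a := a) (b := b) (x' := invertOn S x) (a' := a⁻¹) (b' := b)]
  · rw [Finset.prod_insert h0]
    simp [shiftTwo_apply]
  · rw [Finset.card_insert_of_notMem h0, Finset.card_map]
    exact hS.add_one
  · simp [shiftTwo_apply, hx, ha]
  · funext i
    refine Fin.cases ?_ (fun i => Fin.cases ?_ (fun i => ?_) i) i
    · simp [invertOn]
    · simp [invertOn, shiftTwo_apply, Fin.succ_succ_ne_one]
    · simp [invertOn, shiftTwo_apply, Fin.succ_ne_zero]

theorem inv_zpow_neg_eq {r x : ℂ} (hr : r ^ 2 = x) (hx : x ≠ 0) (n : ℕ) :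
    r⁻¹ ^ (-(n : ℤ)) = x ^ n * r ^ (-(n : ℤ)) := by
  have h0 : r ≠ 0 := by
    rintro rfl
    exact hx (by rw [← hr]; simp)
  rw [inv_zpow, zpow_neg, inv_inv, zpow_natCast, ← hr, ← pow_mul, mul_comm 2 n, pow_mul]
  field_simp

theorem prod_invertOn_zpow {N : ℕ} {x r : Fin N → ℂ} (hx : ∀ i, x i ≠ 0)
    (hr : ∀ i, r i ^ 2 = x i) (n : ℕ) (S : Finset (Fin N)) :
    ∏ i, invertOn S r i ^ (-(n : ℤ)) = (∏ i ∈ S, x i) ^ n * ∏ i, r i ^ (-(n : ℤ)) := by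
  have h1 : ∀ i, invertOn S r i ^ (-(n : ℤ)) =
      (if i ∈ S then x i ^ n else 1) * r i ^ (-(n : ℤ)) := by
    intro i
    rw [invertOn]
    split_ifs
    · exact inv_zpow_neg_eq (hr i) (hx i) n
    · rw [one_mul]
  simp only [h1]
  rw [Finset.prod_mul_distrib, Finset.prod_ite_mem, Finset.univ_inter, Finset.prod_pow]

end

end FreeBoundary

/-- `r i` and `ra, rb, rc, rd` are arbitrary choices of the square roots `x_i^{1/2}` and
`a^{1/2}, b^{1/2}, c^{1/2}, d^{1/2}`, so `x_i^{-n/2}` is `r i ^ (-n)`, and inverting a variable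
inverts its square root. -/
theorem proposition3p6 (n N : ℕ) (q t : ℂ) (hq : ∀ k : ℕ, 0 < k → q ^ k ≠ 1) (ht : ‖t‖ < 1)
    (x r : Fin N → ℂ) (hx : ∀ i, x i ≠ 0) (hr : ∀ i, r i ^ 2 = x i) (a b c d : ℂ) :
    Summable (FreeBoundary.zTerm n x q t a b c d) ∧
    (∀ S : Finset (Fin N), Even S.card →
      (∏ i, FreeBoundary.invertOn S r i ^ (-(n : ℤ))) *
          FreeBoundary.Z n (FreeBoundary.invertOn S x) q t a b c d =
        (∏ i, r i ^ (-(n : ℤ))) * FreeBoundary.Z n x q t a b c d) ∧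
    (∀ ra rb rc rd : ℂ, a ≠ 0 → b ≠ 0 → c ≠ 0 → d ≠ 0 →
      ra ^ 2 = a → rb ^ 2 = b → rc ^ 2 = c → rd ^ 2 = d →
      ∀ S : Finset (Fin N), Odd S.card →
        (ra⁻¹ * rb * rc * rd) ^ (-(n : ℤ)) * (∏ i, FreeBoundary.invertOn S r i ^ (-(n : ℤ))) *
            FreeBoundary.Z n (FreeBoundary.invertOn S x) q t a⁻¹ b c d =
          (ra * rb * rc * rd) ^ (-(n : ℤ)) * (∏ i, r i ^ (-(n : ℤ))) *
            FreeBoundary.Z n x q t a b c d) := by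
  have hprod : ∀ S : Finset (Fin N), (∏ i ∈ S, x i) ≠ 0 :=
    fun S => Finset.prod_ne_zero_iff.2 fun i _ => hx i
  refine ⟨FreeBoundary.summable_zTerm n x q ht a b c d, fun S hS => ?_,
    fun ra rb rc rd ha _ _ _ hra _ _ _ S hS => ?_⟩
  · rw [FreeBoundary.prod_invertOn_zpow hx hr, FreeBoundary.Z_invertOn hq n ht hx a b c d hS]
    have := hprod S
    rw [inv_pow]
    field_simp
  · rw [FreeBoundary.prod_invertOn_zpow hx hr, FreeBoundary.Z_inv_invertOn hq n ht hx ha b c d hS]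
    have h1 : (ra⁻¹ * rb * rc * rd) ^ (-(n : ℤ)) = a ^ n * (ra * rb * rc * rd) ^ (-(n : ℤ)) := by
      simp only [mul_zpow]
      rw [FreeBoundary.inv_zpow_neg_eq hra ha]
      ring
    have := hprod S
    rw [h1, inv_pow, mul_pow]
    field_simp
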